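/- Let $\mathbb K\in\{\mathbb R,\mathbb C\}$, let $B,\bar B$ be Banach spaces over $\mathbb K$, let $k\ge 0$ and $1\le s\le\infty$, and put $r=s+k+1$. Let $G\in C^r(B,\bar B)$ and let $z\in C^r(U,B)$ be a curve with $z(0)=0$, where $U\subset\mathbb K$ is an open neighbourhood of $0$ (for $\mathbb K=\mathbb C$ differentiability is complex, so $G,z$ are holomorphic). Put $L(\varepsilon)=G'[z(\varepsilon)]$. Assume that $L$ is $k$-surjective: for every $\bar y\in\bar B$ there are $b_0,\dots,b_k\in B$ with $L(\varepsilon)\sum_{j=0}^k\varepsilon^jb_j=\varepsilon^k\bar y+O(\varepsilon^{k+1})$. Let $N_i$ be the space of all $b\in B$ of rank at least $i$, i.e. such that $L(\varepsilon)(b+\varepsilon b_1+\dots+\varepsilon^ib_i)=O(\varepsilon^i)$ for some $b_1,\dots,b_i$ (so $N_0=B$), and let $\bar R_i$ be the space of leading coefficients of order $i$, i.e. of all $\bar y\in\bar B$ with $L(\varepsilon)\sum_{j=0}^i\varepsilon^jb_j=\varepsilon^i\bar y+O(\varepsilon^{i+1})$ for some $b_0,\dots,b_i$; put $\bar R_{-1}=\{0\}$.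 Assume that closed subspaces $N_{i+1}^c\subset B$ and $R_{i+1}\subset\bar B$ with $N_i=N_{i+1}^c\oplus N_{i+1}$ and $\bar R_i=\bar R_{i-1}\oplus R_{i+1}$ ($i=0,\dots,k$) are given and that $N_{k+1}$ is closed; thus $B=N_1^c\oplus\dots\oplus N_{k+1}^c\oplus N_{k+1}$ and $\bar B=R_1\oplus\dots\oplus R_{k+1}$. Let $N^c=N_1^c\times\dots\times N_{k+1}^c$ (all products carry the maximum norm). Then there are a polynomial family $p_k(\varepsilon)=I_B+\varepsilon\phi_1+\dots+\varepsilon^k\phi_k$ of bounded operators, $\phi_j\in L[B,N_1^c\oplus\dots\oplus N_{k+1-j}^c]$, and isomorphisms $S_{i+1}\in GL[N_{i+1}^c,R_{i+1}]$ such that, for $i=0,\dots,k$, $$L(\varepsilon)p_k(\varepsilon)n_{i+1}^c=\varepsilon^iS_{i+1}n^c_{i+1}+O(\varepsilon^{i+1}),\qquad L(\varepsilon)p_k(\varepsilon)n_{k+1}=O(\varepsilon^{k+1})$$ for all $n_{i+1}^c\in N_{i+1}^c$, $n_{k+1}\in N_{k+1}$; and for every such choice the operator $(S_1\cdots S_{k+1})\varphi=\sum_iS_i\varphi_i$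 is in $GL[N^c,\bar B]$. Moreover, for every $M>0$ there are $\rho,\delta>0$ (depending only on $\mathbb K,B,\bar B,k,s,M$) such that the following holds for all data $U,z,G,N_i^c,R_i,\phi_i,S_i$ as above with $\|(S_1\cdots S_{k+1})^{-1}\|\le M$ and $\|G''[x]\|\le M$ for $\|x\|\le 1/M$. Put $V=\{(\varphi,n)\in N^c\times N_{k+1}:\|(\varphi,n)\|<\rho\}$. There are an open neighbourhood $U_0\subset U$ of $0$ and a $C^s$ map $\psi^c=(\psi^c_1,\dots,\psi^c_{k+1}):U_0\times V\to N^c$ such that, with $\Psi^c=\varepsilon^k\psi^c_1+\dots+\varepsilon\psi^c_k+\psi^c_{k+1}$ and $$Z(\varepsilon,\varphi,n)=z(\varepsilon)+\varepsilon^kp_k(\varepsilon)\{\Psi^c(\varepsilon,\varphi,n)+n\},$$ one has: $\psi^c(\varepsilon,0,0)=0$; $\psi^c(0,\varphi,n)=\varphi+\chi(\varphi_{k+1},n)$ with $\|\chi(\varphi_{k+1},n)\|\le C\|(\varphi_{k+1},n)\|^2$ on $V$ for a constant $C$; the linearization $G[Z(\varepsilon,\varphi,n)]=G[z(\varepsilon)]+\varepsilon^{2k}(S_1\cdots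 S_{k+1})\varphi$ on $U_0\times V$; for each fixed $\varepsilon\in U_0\setminus\{0\}$, $Z(\varepsilon,\cdot)$ is a $C^s$ diffeomorphism of $V$ onto an open neighbourhood of $z(\varepsilon)$; and furthermore: (i) Let $G[z(\varepsilon)]=\varepsilon^{2k}\bar b(\varepsilon)$ on $U$ with $\bar b$ continuous at $0$ and $\|\bar b(0)\|<\delta$, and put $\varphi_0(\varepsilon)=-(S_1\cdots S_{k+1})^{-1}\bar b(\varepsilon)\in N^c$. Then there is an open neighbourhood $U_1\subset U_0$ of $0$ such that for $\varepsilon\in U_1$ one has $\|\varphi_0(\varepsilon)\|<\rho$ and $$G[Z(\varepsilon,\varphi+\varphi_0(\varepsilon),n)]=\varepsilon^{2k}(S_1\cdots S_{k+1})\varphi\quad\text{whenever }(\varphi+\varphi_0(\varepsilon),n)\in V,$$ and the set of all zeros of $G$ in the generalized cone $\{Z(\varepsilon,\bar\varphi,n):\varepsilon\in U_1\setminus\{0\},(\bar\varphi,n)\in V\}$ is exactly $\{Z(\varepsilon,\varphi_0(\varepsilon),n):\varepsilon\in U_1\setminus\{0\},\ n\in N_{k+1},\ \|n\|<\rho\}$.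 (ii) If $k\ge1$ and $G[z(\varepsilon)]=\varepsilon^q\bar b(\varepsilon)$ on $U$ with $0\le q\le 2k-1$, $\bar b$ continuous at $0$ and $\bar b(0)\ne0$, then there is an open neighbourhood $U_1\subset U_0$ of $0$ such that $G$ has no zero in the cone $\{Z(\varepsilon,\varphi,n):\varepsilon\in U_1\setminus\{0\},(\varphi,n)\in V\}$. -/

import Mathlib

open Set Filter Topology Asymptotics

noncomputable section

namespace NewtonLemma

variable {𝕜 : Type*} [RCLike 𝕜]
  {B : Type*} [NormedAddCommGroup B] [NormedSpace 𝕜 B]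
  {F : Type*} [NormedAddCommGroup F] [NormedSpace 𝕜 F]

/-- The polynomial curve `c 0 + ε c 1 + ... + ε ^ k c k`. -/
def curve (c : ℕ → B) (k : ℕ) (ε : 𝕜) : B :=
  ∑ j ∈ Finset.range (k + 1), ε ^ j • c j

lemma curve_add (c d : ℕ → B) (k : ℕ) (ε : 𝕜) :
    curve (c + d) k ε = curve c k ε + curve d k ε := by
  simp [curve, Finset.sum_add_distrib]

lemma curve_smul (a : 𝕜) (c : ℕ → B) (k : ℕ) (ε : 𝕜) :
    curve (a • c) k ε = a • curve c k ε := by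
  simp [curve, Finset.smul_sum, smul_comm a]

/-- The family `L` of operators is `k`-surjective: for every `y` there is a curve of degree `k`
with `L(ε) (c 0 + ... + ε ^ k c k) = ε ^ k y + O(ε ^ (k + 1))`. -/
def KSurjective (L : 𝕜 → B →L[𝕜] F) (k : ℕ) : Prop :=
  ∀ y : F, ∃ c : ℕ → B,
    (fun ε : 𝕜 => L ε (curve c k ε) - ε ^ k • y) =O[𝓝 0] fun ε : 𝕜 => ε ^ (k + 1)

/-- The subspace `N i` of all `b` of rank at least `i`: `b` is the starting point of a curve with
`L(ε) (b + ε c 1 + ...) = O(ε ^ i)`. In particular `N 0 = B` and `N 1` is the kernel of `L 0`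
when `L` is differentiable at `0`. -/
def rankSub (L : 𝕜 → B →L[𝕜] F) (i : ℕ) : Submodule 𝕜 B where
  carrier := {b | ∃ c : ℕ → B, c 0 = b ∧
    (fun ε : 𝕜 => L ε (curve c i ε)) =O[𝓝 0] fun ε : 𝕜 => ε ^ i}
  zero_mem' := ⟨0, rfl, by simpa [curve] using isBigO_zero _ _⟩
  add_mem' := by
    rintro a b ⟨c, rfl, hc⟩ ⟨d, rfl, hd⟩
    refine ⟨c + d, rfl, ?_⟩
    simpa only [curve_add, map_add] using hc.add hd
  smul_mem' := by
    rintro a b ⟨c, rfl, hc⟩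
    refine ⟨a • c, rfl, ?_⟩
    exact (hc.const_smul_left a).congr_left fun ε => by rw [curve_smul, map_smul, Pi.smul_apply]

/-- The subspace of all leading coefficients of order `i`, that is, of all `y` with
`L(ε) (c 0 + ... + ε ^ i c i) = ε ^ i y + O(ε ^ (i + 1))` for some curve. -/
def leadSub (L : 𝕜 → B →L[𝕜] F) (i : ℕ) : Submodule 𝕜 F where
  carrier := {y | ∃ c : ℕ → B,
    (fun ε : 𝕜 => L ε (curve c i ε) - ε ^ i • y) =O[𝓝 0] fun ε : 𝕜 => ε ^ (i + 1)}
  zero_mem' := ⟨0, by simpa [curve] using isBigO_zero _ _⟩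
  add_mem' := by
    rintro a b ⟨c, hc⟩ ⟨d, hd⟩
    refine ⟨c + d, (hc.add hd).congr_left fun ε => ?_⟩
    rw [curve_add, map_add, smul_add]
    abel
  smul_mem' := by
    rintro a b ⟨c, hc⟩
    refine ⟨a • c, (hc.const_smul_left a).congr_left fun ε => ?_⟩
    rw [curve_smul, map_smul, Pi.smul_apply, smul_sub, smul_comm a]

/-- The leading coefficients of order less than `i` (they increase with the order). -/
def leadSubBelow (L : 𝕜 → B →L[𝕜] F) : ℕ → Submodule 𝕜 F
  | 0 => ⊥
  | i + 1 => leadSub L i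

/-- Closed direct sums built up by Jordan chains. The index `i = 0, ..., k` stands for the rank:
`Nc i` is a closed complement in `rankSub L i` of `rankSub L (i + 1)`, and `R i` is a closed
complement in `leadSub L i` of the leading coefficients of lower order. Telescoping gives
`B = Nc 0 ⊕ ... ⊕ Nc k ⊕ rankSub L (k + 1)` and, for a `k`-surjective family,
`F = R 0 ⊕ ... ⊕ R k`. -/
structure Decomposition (L : 𝕜 → B →L[𝕜] F) (k : ℕ) where
  Nc : Fin (k + 1) → Submodule 𝕜 B
  R : Fin (k + 1) → Submodule 𝕜 F
  disjoint_Nc : ∀ i : Fin (k + 1), Disjoint (Nc i) (rankSub L (i + 1))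
  sup_Nc : ∀ i : Fin (k + 1), Nc i ⊔ rankSub L (i + 1) = rankSub L i
  disjoint_R : ∀ i : Fin (k + 1), Disjoint (R i) (leadSubBelow L i)
  sup_R : ∀ i : Fin (k + 1), R i ⊔ leadSubBelow L i = leadSub L i
  isClosed_Nc : ∀ i, IsClosed (Nc i : Set B)
  isClosed_N : IsClosed (rankSub L (k + 1) : Set B)
  isClosed_R : ∀ i, IsClosed (R i : Set F)

/-- The product of the complements `Nc 0, ..., Nc k` (with the maximum norm). -/
abbrev Decomposition.NcProd {L : 𝕜 → B →L[𝕜] F} {k : ℕ} (D : Decomposition L k) : Type _ :=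
  ∀ i : Fin (k + 1), D.Nc i

/-- The kernel part `N = rankSub L (k + 1)` of the decomposition of `B`. -/
abbrev Decomposition.N {L : 𝕜 → B →L[𝕜] F} {k : ℕ} (_D : Decomposition L k) : Submodule 𝕜 B :=
  rankSub L (k + 1)

/-- The polynomial family `id + ε φ 1 + ... + ε ^ k φ k` that extends the root elements to Jordan
chains, together with the isomorphisms `S i` that give the leading coefficients:
`L(ε) p(ε) n = ε ^ i S i n + O(ε ^ (i + 1))` for `n` in `Nc i`, and
`L(ε) p(ε) n = O(ε ^ (k + 1))` for `n` in `N`. -/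
structure JordanChains {L : 𝕜 → B →L[𝕜] F} {k : ℕ} (D : Decomposition L k) where
  φ : ℕ → B →L[𝕜] B
  φ_zero : φ 0 = ContinuousLinearMap.id 𝕜 B
  φ_mem : ∀ j, 1 ≤ j → j ≤ k → ∀ b : B,
    φ j b ∈ ⨆ i : {i : Fin (k + 1) // (i : ℕ) + j ≤ k}, D.Nc i
  S : ∀ i : Fin (k + 1), D.Nc i ≃L[𝕜] D.R i
  lead : ∀ (i : Fin (k + 1)) (n : D.Nc i),
    (fun ε : 𝕜 => L ε ((∑ j ∈ Finset.range (k + 1), ε ^ j • φ j) (n : B))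
      - ε ^ (i : ℕ) • (S i n : F)) =O[𝓝 0] fun ε : 𝕜 => ε ^ ((i : ℕ) + 1)
  kernel : ∀ n : D.N,
    (fun ε : 𝕜 => L ε ((∑ j ∈ Finset.range (k + 1), ε ^ j • φ j) (n : B)))
      =O[𝓝 0] fun ε : 𝕜 => ε ^ (k + 1)

namespace JordanChains

variable {L : 𝕜 → B →L[𝕜] F} {k : ℕ} {D : Decomposition L k} (J : JordanChains D)

/-- The operator `p(ε) = id + ε φ 1 + ... + ε ^ k φ k`. -/
def p (ε : 𝕜) : B →L[𝕜] B := ∑ j ∈ Finset.range (k + 1), ε ^ j • J.φ j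

/-- The operator `(S 0 ... S k)`, mapping `(φ 0, ..., φ k)` to `S 0 (φ 0) + ... + S k (φ k)`. -/
def sumS : D.NcProd →L[𝕜] F :=
  ∑ i : Fin (k + 1), (D.R i).subtypeL ∘L (J.S i : D.Nc i →L[𝕜] D.R i) ∘L
    ContinuousLinearMap.proj i

/-- The map `(φ, n) ↦ z(ε) + ε ^ k p(ε) (Ψ(ε, φ, n) + n)`, where
`Ψ = ε ^ k ψ 0 + ε ^ (k - 1) ψ 1 + ... + ψ k`. -/
def coneMap (z : 𝕜 → B) (ψ : 𝕜 → D.NcProd × D.N → D.NcProd) (ε : 𝕜) (v : D.NcProd × D.N) : B :=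
  z ε + ε ^ k • J.p ε ((∑ i : Fin (k + 1), ε ^ (k - (i : ℕ)) • (ψ ε v i : B)) + (v.2 : B))

/-- The generalized cone around the curve `z` with parameters `ε ∈ U \ {0}`, `(φ, n) ∈ V`. -/
def cone (z : 𝕜 → B) (ψ : 𝕜 → D.NcProd × D.N → D.NcProd) (U : Set 𝕜)
    (V : Set (D.NcProd × D.N)) : Set B :=
  {x | ∃ ε ∈ U, ε ≠ 0 ∧ ∃ v ∈ V, x = J.coneMap z ψ ε v}

/-- The map `ψ` is a transformation of class `C^s` on `U × V` that fixes the origin, is a near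
identity at `ε = 0`, linearizes `G` along `z` up to the term `G(z(ε))`, and for each `ε ≠ 0` induces
a diffeomorphism of `V` onto an open neighbourhood of `z(ε)`. -/
structure IsLinearizing (G : B → F) (z : 𝕜 → B) (s : ℕ∞) (U : Set 𝕜)
    (V : Set (D.NcProd × D.N)) (ψ : 𝕜 → D.NcProd × D.N → D.NcProd) : Prop where
  smooth : ContDiffOn 𝕜 s (Function.uncurry ψ) (U ×ˢ V)
  map_zero : ∀ ε ∈ U, ψ ε 0 = 0
  near_id : ∃ (χ : D.Nc (Fin.last k) × D.N → D.NcProd) (C : ℝ), ∀ v ∈ V,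
    ψ 0 v = v.1 + χ (v.1 (Fin.last k), v.2) ∧
      ‖χ (v.1 (Fin.last k), v.2)‖ ≤ C * ‖(v.1 (Fin.last k), v.2)‖ ^ 2
  linear : ∀ ε ∈ U, ∀ v ∈ V,
    G (J.coneMap z ψ ε v) = G (z ε) + ε ^ (2 * k) • J.sumS v.1
  diffeo : ∀ ε ∈ U, ε ≠ 0 → IsOpen (J.coneMap z ψ ε '' V) ∧
    ∃ g : B → D.NcProd × D.N, ContDiffOn 𝕜 s g (J.coneMap z ψ ε '' V) ∧
      ∀ v ∈ V, g (J.coneMap z ψ ε v) = v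

end JordanChains

/-- The family of derivatives of `G` along the curve `z`. -/
def linearization (G : B → F) (z : 𝕜 → B) (ε : 𝕜) : B →L[𝕜] F := fderiv 𝕜 G (z ε)

/-- The map `G` and the curve `z` through the origin are of class `C^r`, and the derivatives of
`G` along `z` are a `k`-surjective family. -/
structure IsSetting (r : ℕ∞) (k : ℕ) (U : Set 𝕜) (z : 𝕜 → B) (G : B → F) : Prop where
  isOpen : IsOpen U
  zero_mem : (0 : 𝕜) ∈ U
  z_zero : z 0 = 0
  z_smooth : ContDiffOn 𝕜 r z U
  G_smooth : ContDiff 𝕜 r G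
  kSurjective : KSurjective (linearization G z) k

end NewtonLemma

end

/-! The proof desingularizes `G` along the curve. Second order Taylor expansion gives `G(z + ε^k u)
= G(z) + ε^k L(ε) u + ε^(2k) h(ε, z, u)` with a smooth `h`. Put `u = p(ε) w(ε) v`, where the weight
`w(ε)` multiplies the component of rank `i` by `ε^(k-i)`. Since the chain of a rank `i` element has
leading order `ε^i`, all components are then balanced at order `ε^k`, so `L(ε) p(ε) w(ε) = ε^k A(ε)`
with `A` smooth and `A(0)(φ, n) = (S 0 ... S k) φ`. Hence the increment of `G` is `ε^(2k) (A(ε) v +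
h)`, and applying the inverse of `(S 0 ... S k)` leaves a family `e(ε, φ, n)` that is close to `φ`.
Solving `e(ε, ψ, n) = φ` for `ψ` linearizes `G`.

Uniformity comes from solving by contraction. The Lipschitz constant of `e - φ` is controlled by the
bound on the inverse and by the bound on the second derivative of `G` near the origin, so the radius
depends only on `M` and `k`; only the neighbourhood of `ε = 0` depends on the data. The implicit
function theorem enters for smoothness alone. At `ε = 0` the weight keeps only the last component
and `n`, which gives the form of `χ`. For `ε ≠ 0` the weight and `p(ε)` are invertible, which gives
the diffeomorphism. Once `G` is linearized, its zeros in the cone are read off from a linear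
equation.

Derivatives are counted as follows: `L` is of class `C^(s+k)`, and dividing by `ε^k` costs `k`
derivatives by Hadamard's lemma; the remainder `h` costs at most two, and only one when `k = 0`.

The chains are built by induction on the order (`PartialChains.exists_succ`). The coefficient of
order `m` on elements of rank at least `m` has components in `R 0, ..., R m`; those below `m` are
removed by subtracting shifted chains found earlier, and the last one restricts to the isomorphism
`S m`.

The main steps are `PartialChains.exists_succ`, `JordanChains.exists_weight_quotient`,
`exists_remainder`, `norm_remainder_sub_le` and `exists_uniform_inverse`. -/

noncomputable section

namespace NewtonLemma

/-! ### Smoothness of integrals over segments. -/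

section ParametricIntegral

universe u v

variable {𝕜 : Type*} [RCLike 𝕜] {E : Type u} [NormedAddCommGroup E] [NormedSpace 𝕜 E]

lemma continuousAt_segment_comp {F : Type*} [NormedAddCommGroup F] [NormedSpace 𝕜 F]
    {O : Set E} (hO : IsOpen O) (P₁ P₂ : E →L[𝕜] E)
    (hP : ∀ t ∈ Icc (0 : ℝ) 1, ∀ x ∈ O, (t : 𝕜) • P₁ x + P₂ x ∈ O)
    {h : E → F} (hh : ContinuousOn h O) (m : ℕ) {x : E} (hx : x ∈ O) {t : ℝ}
    (ht : t ∈ Icc (0 : ℝ) 1) :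
    ContinuousAt (fun q : E × ℝ => (q.2 : 𝕜) ^ m • h ((q.2 : 𝕜) • P₁ q.1 + P₂ q.1)) (x, t) := by
  have h1 : ContinuousAt h ((t : 𝕜) • P₁ x + P₂ x) := hh.continuousAt (hO.mem_nhds (hP t ht x hx))
  have h2 : Continuous (fun q : E × ℝ => (q.2 : 𝕜)) := RCLike.continuous_ofReal.comp continuous_snd
  refine ((h2.pow m).continuousAt).smul (ContinuousAt.comp (f := fun q : E × ℝ =>
    (q.2 : 𝕜) • P₁ q.1 + P₂ q.1) h1 ?_)
  have : Continuous (fun q : E × ℝ => (q.2 : 𝕜) • P₁ q.1 + P₂ q.1) := by fun_prop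
  exact this.continuousAt

/-- Compactness of `[0, 1]` makes a bound near each `t` uniform, which supplies the dominating
constant for continuity and differentiation under the integral. -/
lemma exists_bound_segment_comp {F : Type*} [NormedAddCommGroup F] [NormedSpace 𝕜 F]
    {O : Set E} (hO : IsOpen O) (P₁ P₂ : E →L[𝕜] E)
    (hP : ∀ t ∈ Icc (0 : ℝ) 1, ∀ x ∈ O, (t : 𝕜) • P₁ x + P₂ x ∈ O)
    {h : E → F} (hh : ContinuousOn h O) (m : ℕ) {x : E} (hx : x ∈ O) :
    ∃ C : ℝ, ∀ᶠ y in 𝓝 x, ∀ t ∈ Icc (0 : ℝ) 1,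
      ‖(t : 𝕜) ^ m • h ((t : 𝕜) • P₁ y + P₂ y)‖ ≤ C := by
  have hc := fun t (ht : t ∈ Icc (0 : ℝ) 1) => continuousAt_segment_comp hO P₁ P₂ hP hh m hx ht
  have hc' : ContinuousOn (fun t : ℝ => ‖(t : 𝕜) ^ m • h ((t : 𝕜) • P₁ x + P₂ x)‖) (Icc 0 1) := by
    intro t ht
    refine ContinuousAt.continuousWithinAt ?_
    exact ((hc t ht).comp (f := fun t : ℝ => (x, t)) (by fun_prop)).norm
  obtain ⟨C, hC⟩ := (isCompact_Icc.image_of_continuousOn hc').bddAbove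
  refine ⟨C + 1, ?_⟩
  refine IsCompact.eventually_forall_of_forall_eventually
    (isCompact_Icc (a := (0 : ℝ)) (b := 1))
    (P := fun y t => ‖(t : 𝕜) ^ m • h ((t : 𝕜) • P₁ y + P₂ y)‖ ≤ C + 1) fun t ht => ?_
  have h1 : ‖(t : 𝕜) ^ m • h ((t : 𝕜) • P₁ x + P₂ x)‖ < C + 1 :=
    (hC (mem_image_of_mem _ ht)).trans_lt (lt_add_one C)
  exact ((hc t ht).norm.eventually (gt_mem_nhds h1)).mono fun _ hq => hq.le

lemma intervalIntegrable_segment_comp {F : Type*} [NormedAddCommGroup F] [NormedSpace 𝕜 F]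
    {O : Set E} (hO : IsOpen O) (P₁ P₂ : E →L[𝕜] E)
    (hP : ∀ t ∈ Icc (0 : ℝ) 1, ∀ x ∈ O, (t : 𝕜) • P₁ x + P₂ x ∈ O)
    {h : E → F} (hh : ContinuousOn h O) (m : ℕ) {x : E} (hx : x ∈ O) :
    IntervalIntegrable (fun t : ℝ => (t : 𝕜) ^ m • h ((t : 𝕜) • P₁ x + P₂ x))
      MeasureTheory.volume 0 1 := by
  refine ContinuousOn.intervalIntegrable fun t ht => ContinuousAt.continuousWithinAt ?_
  rw [uIcc_of_le zero_le_one] at ht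
  exact (continuousAt_segment_comp hO P₁ P₂ hP hh m hx ht).comp
    (f := fun t : ℝ => (x, t)) (by fun_prop)

lemma aestronglyMeasurable_segment_comp {F : Type*} [NormedAddCommGroup F] [NormedSpace 𝕜 F]
    {O : Set E} (hO : IsOpen O) (P₁ P₂ : E →L[𝕜] E)
    (hP : ∀ t ∈ Icc (0 : ℝ) 1, ∀ x ∈ O, (t : 𝕜) • P₁ x + P₂ x ∈ O)
    {h : E → F} (hh : ContinuousOn h O) (m : ℕ) {x : E} (hx : x ∈ O) :
    MeasureTheory.AEStronglyMeasurable (fun t : ℝ => (t : 𝕜) ^ m • h ((t : 𝕜) • P₁ x + P₂ x))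
      (MeasureTheory.volume.restrict (uIoc (0 : ℝ) 1)) := by
  have := (intervalIntegrable_segment_comp hO P₁ P₂ hP hh m hx)
  rw [intervalIntegrable_iff] at this
  exact this.aestronglyMeasurable

lemma continuousOn_integral_segment_comp {F : Type*} [NormedAddCommGroup F] [NormedSpace 𝕜 F]
    [NormedSpace ℝ F]
    {O : Set E} (hO : IsOpen O) (P₁ P₂ : E →L[𝕜] E)
    (hP : ∀ t ∈ Icc (0 : ℝ) 1, ∀ x ∈ O, (t : 𝕜) • P₁ x + P₂ x ∈ O)
    {h : E → F} (hh : ContinuousOn h O) (m : ℕ) :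
    ContinuousOn (fun x => ∫ t in (0 : ℝ)..1, (t : 𝕜) ^ m • h ((t : 𝕜) • P₁ x + P₂ x)) O := by
  intro x hx
  refine ContinuousAt.continuousWithinAt ?_
  obtain ⟨C, hC⟩ := exists_bound_segment_comp hO P₁ P₂ hP hh m hx
  refine intervalIntegral.continuousAt_of_dominated_interval (bound := fun _ => C) ?_ ?_ ?_ ?_
  · filter_upwards [hO.mem_nhds hx] with y hy
    exact aestronglyMeasurable_segment_comp hO P₁ P₂ hP hh m hy
  · filter_upwards [hC] with y hy
    refine Eventually.of_forall fun t ht => hy t ?_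
    rw [uIoc_of_le zero_le_one] at ht
    exact ⟨ht.1.le, ht.2⟩
  · simp
  · refine Eventually.of_forall fun t ht => ?_
    rw [uIoc_of_le zero_le_one] at ht
    exact (continuousAt_segment_comp hO P₁ P₂ hP hh m hx ⟨ht.1.le, ht.2⟩).comp
      (f := fun y : E => (y, t)) (by fun_prop)

lemma hasFDerivAt_integral_segment_comp {F : Type*} [NormedAddCommGroup F] [NormedSpace 𝕜 F]
    [NormedSpace ℝ F]
    {O : Set E} (hO : IsOpen O) (P₁ P₂ : E →L[𝕜] E)
    (hP : ∀ t ∈ Icc (0 : ℝ) 1, ∀ x ∈ O, (t : 𝕜) • P₁ x + P₂ x ∈ O)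
    {h : E → F} (hh : ContDiffOn 𝕜 1 h O) (m : ℕ) {x : E} (hx : x ∈ O) :
    HasFDerivAt (fun x => ∫ t in (0 : ℝ)..1, (t : 𝕜) ^ m • h ((t : 𝕜) • P₁ x + P₂ x))
      ((∫ t in (0 : ℝ)..1, (t : 𝕜) ^ (m + 1) •
          (fun y => fderiv 𝕜 h y ∘L P₁) ((t : 𝕜) • P₁ x + P₂ x)) +
        ∫ t in (0 : ℝ)..1, (t : 𝕜) ^ m •
          (fun y => fderiv 𝕜 h y ∘L P₂) ((t : 𝕜) • P₁ x + P₂ x)) x := by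
  have hd : ContinuousOn (fderiv 𝕜 h) O := hh.continuousOn_fderiv_of_isOpen hO le_rfl
  have hd1 : ContinuousOn (fun y => fderiv 𝕜 h y ∘L P₁) O := hd.clm_comp continuousOn_const
  have hd2 : ContinuousOn (fun y => fderiv 𝕜 h y ∘L P₂) O := hd.clm_comp continuousOn_const
  obtain ⟨C₁, hC₁⟩ := exists_bound_segment_comp hO P₁ P₂ hP hd1 (m + 1) hx
  obtain ⟨C₂, hC₂⟩ := exists_bound_segment_comp hO P₁ P₂ hP hd2 m hx
  rw [← intervalIntegral.integral_add
    (intervalIntegrable_segment_comp hO P₁ P₂ hP hd1 (m + 1) hx)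
    (intervalIntegrable_segment_comp hO P₁ P₂ hP hd2 m hx)]
  have hs := (hC₁.and hC₂).and (hO.mem_nhds hx)
  refine intervalIntegral.hasFDerivAt_integral_of_dominated_of_fderiv_le
    (F' := fun y (t : ℝ) => (t : 𝕜) ^ (m + 1) •
        (fun y => fderiv 𝕜 h y ∘L P₁) ((t : 𝕜) • P₁ y + P₂ y) +
      (t : 𝕜) ^ m • (fun y => fderiv 𝕜 h y ∘L P₂) ((t : 𝕜) • P₁ y + P₂ y))
    (bound := fun _ => C₁ + C₂) hs ?_ ?_ ?_ ?_ ?_ ?_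
  · filter_upwards [hO.mem_nhds hx] with y hy
    exact aestronglyMeasurable_segment_comp hO P₁ P₂ hP hh.continuousOn m hy
  · exact intervalIntegrable_segment_comp hO P₁ P₂ hP hh.continuousOn m hx
  · exact (aestronglyMeasurable_segment_comp hO P₁ P₂ hP hd1 (m + 1) hx).add
      (aestronglyMeasurable_segment_comp hO P₁ P₂ hP hd2 m hx)
  · refine Eventually.of_forall fun t ht y hy => ?_
    rw [uIoc_of_le zero_le_one] at ht
    have ht' : t ∈ Icc (0 : ℝ) 1 := ⟨ht.1.le, ht.2⟩
    exact (norm_add_le _ _).trans (add_le_add (hy.1.1 t ht') (hy.1.2 t ht'))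
  · simp
  · refine Eventually.of_forall fun t ht y hy => ?_
    rw [uIoc_of_le zero_le_one] at ht
    have hmem := hP t ⟨ht.1.le, ht.2⟩ y hy.2
    have h1 : HasFDerivAt h (fderiv 𝕜 h ((t : 𝕜) • P₁ y + P₂ y)) ((t : 𝕜) • P₁ y + P₂ y) :=
      ((hh.differentiableOn one_ne_zero).differentiableAt (hO.mem_nhds hmem)).hasFDerivAt
    have h2 : HasFDerivAt (fun z => (t : 𝕜) • P₁ z + P₂ z) ((t : 𝕜) • P₁ + P₂) y :=
      ((t : 𝕜) • P₁ + P₂).hasFDerivAt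
    refine ((h1.comp y h2).const_smul ((t : 𝕜) ^ m)).congr_fderiv ?_
    simp [pow_succ, mul_smul, ContinuousLinearMap.comp_add]

/-- Induction by differentiation under the integral. The exponent `m` stays free because the chain
rule through `t • P₁` raises it by one. The derivative takes values in operators from `E` to `F`, so
the universe of `F` has to absorb that of `E` for the induction hypothesis to apply. -/
lemma contDiffOn_integral_segment_comp (n : ℕ) {F : Type (max u v)} [NormedAddCommGroup F]
    [NormedSpace 𝕜 F] [NormedSpace ℝ F]
    {O : Set E} (hO : IsOpen O) (P₁ P₂ : E →L[𝕜] E)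
    (hP : ∀ t ∈ Icc (0 : ℝ) 1, ∀ x ∈ O, (t : 𝕜) • P₁ x + P₂ x ∈ O)
    {h : E → F} (hh : ContDiffOn 𝕜 n h O) (m : ℕ) :
    ContDiffOn 𝕜 n
      (fun x => ∫ t in (0 : ℝ)..1, (t : 𝕜) ^ m • h ((t : 𝕜) • P₁ x + P₂ x)) O := by
  induction n generalizing F m with
  | zero =>
    simp only [Nat.cast_zero, contDiffOn_zero] at hh ⊢
    exact continuousOn_integral_segment_comp hO P₁ P₂ hP hh m
  | succ n ih =>
    have h1 : ContDiffOn 𝕜 1 h O := hh.of_le (by simp)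
    have hf := fun x (hx : x ∈ O) => hasFDerivAt_integral_segment_comp hO P₁ P₂ hP h1 m hx
    have hh' := hh
    rw [Nat.cast_succ, contDiffOn_succ_iff_fderiv_of_isOpen hO] at hh' ⊢
    refine ⟨fun x hx => (hf x hx).differentiableAt.differentiableWithinAt, by simp, ?_⟩
    have hd1 : ContDiffOn 𝕜 n (fun y => fderiv 𝕜 h y ∘L P₁) O := hh'.2.2.clm_comp contDiffOn_const
    have hd2 : ContDiffOn 𝕜 n (fun y => fderiv 𝕜 h y ∘L P₂) O := hh'.2.2.clm_comp contDiffOn_const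
    exact ((ih hd1 (m + 1)).add (ih hd2 m)).congr fun x hx => (hf x hx).fderiv

end ParametricIntegral

/-! ### Hadamard's lemma and the quadratic Taylor remainder. -/

section Hadamard

universe u v

variable {𝕜 : Type*} [RCLike 𝕜] {E : Type u} [NormedAddCommGroup E] [NormedSpace 𝕜 E]

lemma exists_hadamard_quotient_aux {F : Type (max u v)} [NormedAddCommGroup F]
    [NormedSpace 𝕜 F] [CompleteSpace F] {O : Set E} (hO : IsOpen O) (l : E →L[𝕜] 𝕜) (e : E)
    (hP : ∀ t ∈ Icc (0 : ℝ) 1, ∀ x ∈ O, (t : 𝕜) • l x • e + (x - l x • e) ∈ O)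
    {n : ℕ∞} {f : E → F} (hf : ContDiffOn 𝕜 (n + 1) f O) :
    ∃ g : E → F, ContDiffOn 𝕜 n g O ∧ ∀ x ∈ O, f x = f (x - l x • e) + l x • g x := by
  let _ : NormedSpace ℝ F := NormedSpace.restrictScalars ℝ 𝕜 F
  set P₁ : E →L[𝕜] E := l.smulRight e with hP₁
  set P₂ : E →L[𝕜] E := ContinuousLinearMap.id 𝕜 E - l.smulRight e with hP₂
  have hP' : ∀ t ∈ Icc (0 : ℝ) 1, ∀ x ∈ O, (t : 𝕜) • P₁ x + P₂ x ∈ O := by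
    intro t ht x hx
    simpa [hP₁, hP₂] using hP t ht x hx
  have hfd : ContDiffOn 𝕜 n (fun x => fderiv 𝕜 f x e) O :=
    (hf.fderiv_of_isOpen hO le_rfl).clm_apply contDiffOn_const
  -- The quotient is the mean of the derivative in direction `e` over the segment from `x - l x • e`
  -- to `x`. The parameter is real also when the scalars are complex.
  refine ⟨fun x => ∫ t in (0 : ℝ)..1, (t : 𝕜) ^ 0 •
    (fun y => fderiv 𝕜 f y e) ((t : 𝕜) • P₁ x + P₂ x), ?_, fun x hx => ?_⟩
  · rw [contDiffOn_iff_forall_nat_le] at hfd ⊢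
    exact fun m hm => contDiffOn_integral_segment_comp.{u, v} m hO P₁ P₂ hP' (hfd m hm) 0
  · have h0 : ∀ t ∈ uIcc (0 : ℝ) 1, HasDerivAt (fun t : ℝ => f ((t : 𝕜) • P₁ x + P₂ x))
        (fderiv 𝕜 f ((t : 𝕜) • P₁ x + P₂ x) (P₁ x)) t := by
      intro t ht
      rw [uIcc_of_le zero_le_one] at ht
      have h1 : HasFDerivAt f (fderiv 𝕜 f ((t : 𝕜) • P₁ x + P₂ x)) ((t : 𝕜) • P₁ x + P₂ x) :=
        ((hf.differentiableOn (by simp)).differentiableAt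
          (hO.mem_nhds (hP' t ht x hx))).hasFDerivAt
      have h2 : HasDerivAt (fun t : ℝ => (t : 𝕜)) (1 : 𝕜) t := by
        simpa using (RCLike.ofRealCLM (K := 𝕜)).hasDerivAt (x := t)
      let _ : NormedSpace ℝ E := NormedSpace.restrictScalars ℝ 𝕜 E
      have h3 : HasDerivAt (fun t : ℝ => (t : 𝕜) • P₁ x + P₂ x) (P₁ x) t := by
        simpa using (h2.smul_const (P₁ x)).add_const (P₂ x)
      exact (h1.restrictScalars ℝ).comp_hasDerivAt t h3
    have hint : IntervalIntegrable (fun t : ℝ => fderiv 𝕜 f ((t : 𝕜) • P₁ x + P₂ x) (P₁ x))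
        MeasureTheory.volume 0 1 := by
      have := (intervalIntegrable_segment_comp hO P₁ P₂ hP' hfd.continuousOn 0 hx).smul (l x)
      simpa [hP₁, Pi.smul_def] using this
    have h4 := intervalIntegral.integral_eq_sub_of_hasDerivAt h0 hint
    have h5 : ∫ t in (0 : ℝ)..1, fderiv 𝕜 f ((t : 𝕜) • P₁ x + P₂ x) (P₁ x) =
        l x • ∫ t in (0 : ℝ)..1, (t : 𝕜) ^ 0 •
          (fun y => fderiv 𝕜 f y e) ((t : 𝕜) • P₁ x + P₂ x) := by
      rw [← intervalIntegral.integral_smul]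
      simp [hP₁]
    rw [h5] at h4
    rw [h4]
    simp [hP₁, hP₂]

/-- Hadamard's lemma: the increment of a function in one direction is divisible by the coordinate,
with a quotient that has one derivative less. -/
lemma exists_hadamard_quotient {F : Type v} [NormedAddCommGroup F]
    [NormedSpace 𝕜 F] [CompleteSpace F] {O : Set E} (hO : IsOpen O) (l : E →L[𝕜] 𝕜) (e : E)
    (hP : ∀ t ∈ Icc (0 : ℝ) 1, ∀ x ∈ O, (t : 𝕜) • l x • e + (x - l x • e) ∈ O)
    {n : ℕ∞} {f : E → F} (hf : ContDiffOn 𝕜 (n + 1) f O) :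
    ∃ g : E → F, ContDiffOn 𝕜 n g O ∧ ∀ x ∈ O, f x = f (x - l x • e) + l x • g x := by
  -- Lifting `F` removes the universe restriction of the auxiliary version.
  let i : ULift.{u} F ≃L[𝕜] F := ContinuousLinearEquiv.ulift
  obtain ⟨g, hg, h⟩ := exists_hadamard_quotient_aux.{u, max u v} (F := ULift.{u} F) hO l e hP
    (i.symm.contDiff.comp_contDiffOn hf)
  refine ⟨i ∘ g, i.contDiff.comp_contDiffOn hg, fun x hx => ?_⟩
  have := congrArg i (h x hx)
  simpa using this

/-- Hadamard's lemma on a ball of the scalar field. -/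
lemma exists_hadamard_quotient_ball {F : Type v} [NormedAddCommGroup F]
    [NormedSpace 𝕜 F] [CompleteSpace F] {r : ℝ} {n : ℕ∞} {f : 𝕜 → F}
    (hf : ContDiffOn 𝕜 (n + 1) f (Metric.ball 0 r)) :
    ∃ g : 𝕜 → F, ContDiffOn 𝕜 n g (Metric.ball 0 r) ∧
      ∀ x ∈ Metric.ball (0 : 𝕜) r, f x = f 0 + x • g x := by
  have := exists_hadamard_quotient Metric.isOpen_ball (ContinuousLinearMap.id 𝕜 𝕜) 1 ?_ hf
  · simpa using this
  · intro t ht x hx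
    simp only [ContinuousLinearMap.id_apply, smul_eq_mul, mul_one, sub_self, add_zero,
      mem_ball_zero_iff, norm_mul, RCLike.norm_ofReal] at hx ⊢
    rw [abs_of_nonneg ht.1]
    exact (mul_le_of_le_one_left (norm_nonneg _) ht.2).trans_lt hx

/-- Second order Taylor formula along lines: the quadratic remainder is smooth in all variables. -/
lemma exists_quadratic_remainder {B F : Type*} [NormedAddCommGroup B] [NormedSpace 𝕜 B]
    [NormedAddCommGroup F] [NormedSpace 𝕜 F] [CompleteSpace F] {n : ℕ∞} {G : B → F}
    (hG : ContDiff 𝕜 (n + 1 + 1) G) :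
    ∃ Q : 𝕜 × B × B → F, ContDiff 𝕜 n Q ∧ ∀ (τ : 𝕜) (x u : B),
      G (x + τ • u) = G x + τ • fderiv 𝕜 G x u + τ ^ 2 • Q (τ, x, u) := by
  have key : ∀ (m : ℕ∞) (f : 𝕜 × B × B → F), ContDiff 𝕜 (m + 1) f →
      ∃ g : 𝕜 × B × B → F, ContDiff 𝕜 m g ∧ ∀ q, f q = f (0, q.2) + q.1 • g q := by
    intro m f hf
    obtain ⟨g, hg, h⟩ := exists_hadamard_quotient isOpen_univ
      (ContinuousLinearMap.fst 𝕜 𝕜 (B × B)) (1, 0) (fun _ _ _ _ => mem_univ _) hf.contDiffOn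
    refine ⟨g, contDiffOn_univ.1 hg, fun q => ?_⟩
    have := h q (mem_univ _)
    have h2 : q - q.1 • ((1 : 𝕜), (0 : B × B)) = (0, q.2) := by ext <;> simp
    simpa only [ContinuousLinearMap.coe_fst', h2] using this
  have hf : ContDiff 𝕜 (n + 1 + 1) (fun q : 𝕜 × B × B => G (q.2.1 + q.1 • q.2.2)) :=
    hG.comp (by fun_prop)
  obtain ⟨g, hg, h1⟩ := key (n + 1) _ (by exact_mod_cast hf)
  obtain ⟨Q, hQ, h2⟩ := key n g (by exact_mod_cast hg)
  refine ⟨Q, hQ, fun τ x u => ?_⟩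
  -- Both sides are the derivative of `τ ↦ G (x + τ • u)` at `0`, the right one as the limit of
  -- difference quotients.
  have h3 : fderiv 𝕜 G x u = g (0, x, u) := by
    have hd : HasDerivAt (fun τ : 𝕜 => G (x + τ • u)) (fderiv 𝕜 G x u) 0 := by
      have h4 : HasFDerivAt G (fderiv 𝕜 G x) (x + (0 : 𝕜) • u) := by
        simpa using (hG.differentiable (by simp) x).hasFDerivAt
      have h5 : HasDerivAt (fun τ : 𝕜 => x + τ • u) u 0 := by
        simpa using ((hasDerivAt_id (0 : 𝕜)).smul_const u).const_add x
      exact h4.comp_hasDerivAt 0 h5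
    have hd2 : HasDerivAt (fun τ : 𝕜 => G (x + τ • u)) (g (0, x, u)) 0 := by
      rw [hasDerivAt_iff_tendsto_slope]
      have hc : Tendsto (fun τ : 𝕜 => g (τ, x, u)) (𝓝[≠] 0) (𝓝 (g (0, x, u))) := by
        have : Continuous (fun τ : 𝕜 => g (τ, x, u)) := hg.continuous.comp (by fun_prop)
        exact this.continuousAt.tendsto.mono_left nhdsWithin_le_nhds
      refine hc.congr' ?_
      filter_upwards [self_mem_nhdsWithin] with τ hτ
      have := h1 (τ, x, u)
      simp only at this
      rw [slope_def_module, this]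
      simp [smul_smul, inv_mul_cancel₀ hτ]
    exact hd.unique hd2
  have h4 := h1 (τ, x, u)
  have h5 := h2 (τ, x, u)
  simp only [zero_smul, add_zero] at h4 h5
  rw [h4, h5, h3, smul_add, smul_smul, ← pow_two, add_assoc]

end Hadamard

/-! ### Division of operator families by powers of `ε`. -/

section Division

variable {𝕜 : Type*} [RCLike 𝕜] {F : Type*} [NormedAddCommGroup F] [NormedSpace 𝕜 F]

/-- Letting `ε → 0` in the inequality yields it at `0`. Powers of `ε` can be cancelled only off `0`,
so estimates are kept on punctured neighbourhoods and transferred where a full one is required. -/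
lemma isBigO_nhds_of_punctured {X Y : Type*} [NormedAddCommGroup X] [NormedAddCommGroup Y]
    {f : 𝕜 → X} {g : 𝕜 → Y} (hf : ContinuousAt f 0) (hg : ContinuousAt g 0)
    (h : f =O[𝓝[≠] 0] g) : f =O[𝓝 0] g := by
  obtain ⟨C, hC⟩ := h.bound
  have h0 : ‖f 0‖ ≤ C * ‖g 0‖ := by
    refine le_of_tendsto_of_tendsto (b := 𝓝[≠] (0 : 𝕜)) ?_ ?_ hC
    · exact hf.norm.tendsto.mono_left nhdsWithin_le_nhds
    · exact (hg.norm.const_mul C).tendsto.mono_left nhdsWithin_le_nhds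
  refine IsBigO.of_bound C ?_
  rw [eventually_nhdsWithin_iff] at hC
  filter_upwards [hC] with x hx
  by_cases hx0 : x = 0
  · rwa [hx0]
  · exact hx hx0

omit [NormedSpace 𝕜 F] in
lemma eq_zero_of_isBigO_pow_succ {f : 𝕜 → F} (hf : ContinuousAt f 0) {m : ℕ}
    (h : f =O[𝓝[≠] 0] fun ε : 𝕜 => ε ^ (m + 1)) : f 0 = 0 := by
  have hg : ContinuousAt (fun ε : 𝕜 => ε ^ (m + 1)) 0 := (continuous_pow _).continuousAt
  obtain ⟨C, hC⟩ := (isBigO_nhds_of_punctured hf hg h).bound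
  have h0 := hC.self_of_nhds
  simpa using h0

lemma isBigO_of_smul_isBigO {f : 𝕜 → F} {m d : ℕ}
    (h : (fun ε : 𝕜 => ε ^ d • f ε) =O[𝓝[≠] 0] fun ε : 𝕜 => ε ^ (m + d)) :
    f =O[𝓝[≠] 0] fun ε : 𝕜 => ε ^ m := by
  obtain ⟨C, hC⟩ := h.bound
  refine IsBigO.of_bound C ?_
  filter_upwards [hC, self_mem_nhdsWithin] with x hx hx0
  rw [norm_smul, pow_add, norm_mul, mul_comm ‖x ^ m‖, mul_left_comm] at hx
  exact le_of_mul_le_mul_left hx (norm_pos_iff.2 (pow_ne_zero d hx0))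

lemma smul_isBigO {f : 𝕜 → F} {m d : ℕ} {l : Filter 𝕜} (h : f =O[l] fun ε : 𝕜 => ε ^ m) :
    (fun ε : 𝕜 => ε ^ d • f ε) =O[l] fun ε : 𝕜 => ε ^ (m + d) := by
  refine ((isBigO_refl (fun ε : 𝕜 => ε ^ d) l).smul h).congr_right fun ε => ?_
  rw [smul_eq_mul, pow_add, mul_comm]

variable {X Y : Type*} [NormedAddCommGroup X] [NormedSpace 𝕜 X] [NormedAddCommGroup Y]
  [NormedSpace 𝕜 Y] [CompleteSpace Y]

/-- A smooth family of operators that is pointwise of order `k` is divisible by `ε ^ k`. -/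
lemma exists_pow_quotient {r : ℝ} (hr : 0 < r) {n : ℕ∞} (k : ℕ) {f : 𝕜 → X →L[𝕜] Y}
    (hf : ContDiffOn 𝕜 (n + k) f (Metric.ball 0 r))
    (h : ∀ v, (fun ε => f ε v) =O[𝓝[≠] 0] fun ε : 𝕜 => ε ^ k) :
    ∃ A : 𝕜 → X →L[𝕜] Y, ContDiffOn 𝕜 n A (Metric.ball 0 r) ∧
      ∀ ε ∈ Metric.ball (0 : 𝕜) r, f ε = ε ^ k • A ε := by
  induction k generalizing f with
  | zero => exact ⟨f, by simpa using hf, by simp⟩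
  | succ k ih =>
    have hball : Metric.ball (0 : 𝕜) r ∈ 𝓝 0 := Metric.ball_mem_nhds 0 hr
    obtain ⟨g, hg, hfg⟩ := exists_hadamard_quotient_ball (n := n + k) (f := f) (r := r)
      (by simpa [add_assoc] using hf)
    have hf0 : f 0 = 0 := by
      ext v
      refine eq_zero_of_isBigO_pow_succ (f := fun ε => f ε v) ?_ (h v)
      exact (hf.continuousOn.continuousAt hball).clm_apply continuousAt_const
    obtain ⟨A, hA, hgA⟩ := ih (by exact_mod_cast hg) fun v => by
      refine isBigO_of_smul_isBigO (d := 1) (IsBigO.congr' (h v) ?_ .rfl)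
      filter_upwards [nhdsWithin_le_nhds hball] with ε hε
      rw [hfg ε hε, hf0]
      simp
    refine ⟨A, hA, fun ε hε => ?_⟩
    rw [hfg ε hε, hf0, hgA ε hε, zero_add, smul_smul, pow_succ']

/-- The coefficient of order `m` of a smooth family of operators. -/
lemma exists_coefficient (m : ℕ) {f : 𝕜 → X →L[𝕜] Y} (hf : ContDiffAt 𝕜 (m + 1 : ℕ) f 0) :
    ∃ T : X →L[𝕜] Y, ∀ v, (fun ε => f ε v) =O[𝓝[≠] 0] (fun ε : 𝕜 => ε ^ m) →
      (fun ε => f ε v - ε ^ m • T v) =O[𝓝[≠] 0] fun ε : 𝕜 => ε ^ (m + 1) := by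
  induction m generalizing f with
  | zero =>
    refine ⟨f 0, fun v _ => ?_⟩
    have hd : DifferentiableAt 𝕜 (fun ε => f ε v) 0 :=
      (hf.differentiableAt (by simp)).clm_apply (differentiableAt_const v)
    simpa using hd.isBigO_sub.mono nhdsWithin_le_nhds
  | succ m ih =>
    obtain ⟨u, hu, hfu⟩ := hf.contDiffOn le_rfl (by simp)
    obtain ⟨r, hr, hru⟩ := Metric.mem_nhds_iff.1 hu
    have hball : Metric.ball (0 : 𝕜) r ∈ 𝓝 0 := Metric.ball_mem_nhds 0 hr
    obtain ⟨g, hg, hfg⟩ := exists_hadamard_quotient_ball (n := (m + 1 : ℕ)) (f := f)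
      (by exact_mod_cast (hfu.mono (by simpa using hru)))
    obtain ⟨T, hT⟩ := ih (f := g) (by exact_mod_cast hg.contDiffAt hball)
    refine ⟨T, fun v hv => ?_⟩
    -- `T` is chosen before `v`; the order hypothesis on `v` serves only to discard `f 0 v` and pass
    -- to the quotient `g`.
    have hf0 : f 0 v = 0 := eq_zero_of_isBigO_pow_succ (f := fun ε => f ε v)
      (hf.continuousAt.clm_apply continuousAt_const) hv
    have h1 : (fun ε => f ε v) =ᶠ[𝓝[≠] 0] fun ε => ε ^ 1 • g ε v := by
      filter_upwards [nhdsWithin_le_nhds hball] with ε hε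
      rw [hfg ε hε]
      simp [hf0]
    have h2 := smul_isBigO (d := 1) (hT v (isBigO_of_smul_isBigO (d := 1) (hv.congr' h1 .rfl)))
    refine h2.congr' ?_ .rfl
    filter_upwards [h1] with ε hε
    rw [hε, smul_sub, smul_smul, ← pow_add, add_comm 1 m]

end Division

/-! ### Inversion of near projections on a ball of controlled radius. -/

section UniformInverse

variable {𝕜 : Type*} [RCLike 𝕜] {X Y : Type*} [NormedAddCommGroup X] [NormedSpace 𝕜 X]
  [CompleteSpace X] [NormedAddCommGroup Y] [NormedSpace 𝕜 Y]

/-- The map `x ↦ v.1 - (e (x, v.2) - x)` is a `1/4`-contraction. It preserves the ball of radius `2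
* ‖v‖`, since `‖v‖ + (1/4) * 2 * ‖v‖ ≤ 2 * ‖v‖`, and this ball lies inside radius `R / 2`. -/
lemma exists_solution {R : ℝ} {e : X × Y → X} (h0 : e 0 = 0)
    (hlip : ∀ v₁ ∈ Metric.ball (0 : X × Y) R, ∀ v₂ ∈ Metric.ball (0 : X × Y) R,
      ‖(e v₁ - v₁.1) - (e v₂ - v₂.1)‖ ≤ 1 / 4 * ‖v₁ - v₂‖)
    {v : X × Y} (hv : ‖v‖ < R / 4) :
    ∃ x : X, ‖x‖ ≤ 2 * ‖v‖ ∧ e (x, v.2) = v.1 := by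
  have hR : 0 < R := by linarith [norm_nonneg v]
  set s : Set X := Metric.closedBall 0 (2 * ‖v‖) with hs
  have hmem : ∀ x ∈ s, (x, v.2) ∈ Metric.ball (0 : X × Y) R := by
    intro x hx
    rw [hs, mem_closedBall_zero_iff] at hx
    rw [mem_ball_zero_iff, Prod.norm_mk, max_lt_iff]
    constructor
    · linarith [norm_nonneg v]
    · linarith [norm_snd_le v, norm_nonneg v]
  set T : X → X := fun x => v.1 - (e (x, v.2) - x) with hT
  have hmaps : MapsTo T s s := by
    intro x hx
    have h1 := hlip _ (hmem x hx) 0 (by simpa using hR)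
    have h2 : ‖(x, v.2)‖ ≤ 2 * ‖v‖ := by
      rw [hs, mem_closedBall_zero_iff] at hx
      rw [Prod.norm_mk, max_le_iff]
      exact ⟨hx, by linarith [norm_snd_le v, norm_nonneg v]⟩
    simp only [h0, Prod.fst_zero, sub_zero] at h1
    rw [hs, mem_closedBall_zero_iff]
    calc ‖v.1 - (e (x, v.2) - x)‖ ≤ ‖v.1‖ + ‖e (x, v.2) - x‖ := norm_sub_le _ _
      _ ≤ 2 * ‖v‖ := by linarith [norm_fst_le v, norm_nonneg v]
  have hc : ContractingWith (1 / 4) (hmaps.restrict T s s) := by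
    refine ⟨by norm_num [← NNReal.coe_lt_coe], LipschitzWith.of_dist_le_mul fun x y => ?_⟩
    have h1 := hlip _ (hmem x x.2) _ (hmem y y.2)
    rw [Subtype.dist_eq, Subtype.dist_eq, dist_eq_norm, dist_eq_norm]
    have h2 : T x - T y = -((e (x, v.2) - x) - (e (y, v.2) - y)) := by simp only [hT]; abel
    rw [MapsTo.val_restrict_apply, MapsTo.val_restrict_apply, h2, norm_neg]
    simpa [Prod.norm_def] using h1
  obtain ⟨x, hx, hfix, -⟩ := ContractingWith.exists_fixedPoint'
    (Metric.isClosed_closedBall.isComplete) hmaps hc (x := 0)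
    (by simp [hs]) (edist_ne_top _ _)
  refine ⟨x, by simpa [hs] using hx, ?_⟩
  have : v.1 - (e (x, v.2) - x) = x := hfix
  rw [sub_eq_iff_eq_add] at this
  rw [this]
  abel

omit [CompleteSpace X] in
lemma solution_unique {R : ℝ} {e : X × Y → X}
    (hlip : ∀ v₁ ∈ Metric.ball (0 : X × Y) R, ∀ v₂ ∈ Metric.ball (0 : X × Y) R,
      ‖(e v₁ - v₁.1) - (e v₂ - v₂.1)‖ ≤ 1 / 4 * ‖v₁ - v₂‖)
    {x₁ x₂ : X} {y : Y} (hx₁ : ‖x₁‖ < R) (hx₂ : ‖x₂‖ < R) (hy : ‖y‖ < R)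
    (h : e (x₁, y) = e (x₂, y)) : x₁ = x₂ := by
  have := hlip (x₁, y) (by simp [hx₁, hy]) (x₂, y) (by simp [hx₂, hy])
  rw [h] at this
  simp only [sub_sub_sub_cancel_left, Prod.mk_sub_mk, sub_self, Prod.norm_mk, norm_zero,
    norm_nonneg, sup_of_le_left] at this
  rw [norm_sub_rev] at this
  have h0 : ‖x₁ - x₂‖ = 0 := by linarith [norm_nonneg (x₁ - x₂)]
  exact sub_eq_zero.1 (norm_eq_zero.1 h0)

/-- Inversion of a family of perturbations of the projection to the first factor, on a ball whose
radius does not depend on the family. -/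
lemma exists_uniform_inverse [CompleteSpace Y] {R : ℝ} {s : WithTop ℕ∞} (hs : s ≠ 0)
    {O : Set 𝕜} (hO : IsOpen O) {e : 𝕜 → X × Y → X}
    (he : ContDiffOn 𝕜 s (Function.uncurry e) (O ×ˢ univ))
    (h0 : ∀ ε ∈ O, e ε 0 = 0)
    (hlip : ∀ ε ∈ O, ∀ v₁ ∈ Metric.ball (0 : X × Y) R, ∀ v₂ ∈ Metric.ball (0 : X × Y) R,
      ‖(e ε v₁ - v₁.1) - (e ε v₂ - v₂.1)‖ ≤ 1 / 4 * ‖v₁ - v₂‖) :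
    ∃ ψ : 𝕜 → X × Y → X,
      (∀ ε ∈ O, ∀ v ∈ Metric.ball (0 : X × Y) (R / 4),
        ‖ψ ε v‖ ≤ 2 * ‖v‖ ∧ e ε (ψ ε v, v.2) = v.1 ∧
        ∀ x : X, ‖x‖ < R → e ε (x, v.2) = v.1 → x = ψ ε v) ∧
      ContDiffOn 𝕜 s (Function.uncurry ψ) (O ×ˢ Metric.ball 0 (R / 4)) := by
  have hex : ∀ (ε : 𝕜) (v : X × Y), ∃ x : X, ε ∈ O → v ∈ Metric.ball (0 : X × Y) (R / 4) →
      ‖x‖ ≤ 2 * ‖v‖ ∧ e ε (x, v.2) = v.1 := by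
    intro ε v
    by_cases h : ε ∈ O ∧ v ∈ Metric.ball (0 : X × Y) (R / 4)
    · obtain ⟨x, hx⟩ := exists_solution (h0 ε h.1) (hlip ε h.1) (mem_ball_zero_iff.1 h.2)
      exact ⟨x, fun _ _ => hx⟩
    · exact ⟨0, fun h1 h2 => absurd ⟨h1, h2⟩ h⟩
  choose ψ hψ using hex
  have huniq : ∀ ε ∈ O, ∀ v ∈ Metric.ball (0 : X × Y) (R / 4), ∀ x : X, ‖x‖ < R →
      e ε (x, v.2) = v.1 → x = ψ ε v := by
    intro ε hε v hv x hx hxe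
    have h1 := hψ ε v hε hv
    rw [mem_ball_zero_iff] at hv
    refine solution_unique (hlip ε hε) hx ?_ ?_ (hxe.trans h1.2.symm)
    · linarith [norm_nonneg v]
    · linarith [norm_snd_le v, norm_nonneg v]
  refine ⟨ψ, fun ε hε v hv => ⟨(hψ ε v hε hv).1, (hψ ε v hε hv).2, huniq ε hε v hv⟩, ?_⟩
  rintro ⟨ε₀, v₀⟩ ⟨hε₀, hv₀⟩
  simp only at hε₀ hv₀
  refine ContDiffAt.contDiffWithinAt ?_
  set x₀ := ψ ε₀ v₀ with hx₀
  have hv₀' : ‖v₀‖ < R / 4 := mem_ball_zero_iff.1 hv₀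
  have hx₀R : ‖x₀‖ < R := by linarith [(hψ ε₀ v₀ hε₀ hv₀).1, norm_nonneg v₀]
  have hv₂ : ‖v₀.2‖ < R := by linarith [norm_snd_le v₀, norm_nonneg v₀]
  -- The implicit function theorem yields a smooth solution on an uncontrolled neighbourhood of the
  -- given point; uniqueness in the ball of radius `R` identifies it with `ψ` there.
  set f : (𝕜 × X × Y) × X → X := fun q => e q.1.1 (q.2, q.1.2.2) - q.1.2.1 with hf
  have hE : ContDiffAt 𝕜 s (Function.uncurry e) (ε₀, (x₀, v₀.2)) :=
    he.contDiffAt ((hO.prod isOpen_univ).mem_nhds ⟨hε₀, mem_univ _⟩)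
  have hcf : ContDiffAt 𝕜 s f ((ε₀, v₀), x₀) := by
    refine ContDiffAt.sub ?_ (by fun_prop)
    exact hE.comp (f := fun q : (𝕜 × X × Y) × X => (q.1.1, (q.2, q.1.2.2))) ((ε₀, v₀), x₀)
      (by fun_prop)
  have hinv : (fderiv 𝕜 f ((ε₀, v₀), x₀) ∘L .inr 𝕜 (𝕜 × X × Y) X).IsInvertible := by
    set T := fderiv 𝕜 f ((ε₀, v₀), x₀) ∘L .inr 𝕜 (𝕜 × X × Y) X with hT
    have h1 : HasFDerivAt (fun x => f ((ε₀, v₀), x) - x) (T - 1) x₀ := by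
      have h2 : HasFDerivAt (fun x : X => ((ε₀, v₀), x)) (.inr 𝕜 (𝕜 × X × Y) X) x₀ :=
        hasFDerivAt_prodMk_right _ _
      exact ((hcf.differentiableAt hs).hasFDerivAt.comp x₀ h2).sub (hasFDerivAt_id x₀)
    -- The Lipschitz constant bounds the derivative of the perturbation, so the partial derivative
    -- `T` is invertible by a Neumann series.
    have h2 : ‖T - 1‖ ≤ 1 / 4 := by
      refine h1.le_of_lip' (by norm_num) ?_
      have : Metric.ball (0 : X) R ∈ 𝓝 x₀ := Metric.isOpen_ball.mem_nhds (by simpa using hx₀R)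
      filter_upwards [this] with x hx
      have h3 := hlip ε₀ hε₀ (x, v₀.2) (by simpa [hv₂] using hx) (x₀, v₀.2) (by simp [hx₀R, hv₂])
      have h4 : f ((ε₀, v₀), x) - x - (f ((ε₀, v₀), x₀) - x₀) =
        (e ε₀ (x, v₀.2) - x) - (e ε₀ (x₀, v₀.2) - x₀) := by simp only [hf]; abel
      rw [h4]
      simpa [Prod.norm_def] using h3
    have h3 : IsUnit (1 - (1 - T)) := by
      refine isUnit_one_sub_of_norm_lt_one ?_
      rw [norm_sub_rev]
      linarith
    rw [sub_sub_cancel] at h3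
    obtain ⟨u, hu⟩ := h3
    exact ⟨ContinuousLinearEquiv.unitsEquiv 𝕜 X u, by rw [← hu]; rfl⟩
  have hg := hcf.contDiffAt_implicitFunction hs hinv
  set g := hcf.implicitFunction hs hinv with hgdef
  have hg0 : g (ε₀, v₀) = x₀ := hcf.implicitFunction_apply_self hs hinv
  have hge := hcf.eventually_apply_implicitFunction hs hinv
  refine hg.congr_of_eventuallyEq ?_
  have hgR : ∀ᶠ q in 𝓝 (ε₀, v₀), ‖g q‖ < R := by
    refine hg.continuousAt.norm.eventually (gt_mem_nhds ?_)
    show ‖g (ε₀, v₀)‖ < R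
    rwa [hg0]
  have hdom : O ×ˢ Metric.ball (0 : X × Y) (R / 4) ∈ 𝓝 (ε₀, v₀) :=
    (hO.prod Metric.isOpen_ball).mem_nhds ⟨hε₀, hv₀⟩
  filter_upwards [hge, hgR, hdom] with q hq hqR hqd
  refine (huniq q.1 hqd.1 q.2 hqd.2 _ hqR ?_).symm
  have h1 : f ((ε₀, v₀), x₀) = 0 := by
    simp only [hf]
    rw [(hψ ε₀ v₀ hε₀ hv₀).2, sub_self]
  rw [h1] at hq
  exact sub_eq_zero.1 hq

end UniformInverse

/-! ### Direct sums adapted to a filtration. -/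

section Chains

variable {𝕜 X : Type*} [NormedField 𝕜] [NormedAddCommGroup X] [NormedSpace 𝕜 X]

/-- The sum of the elements of finitely many subspaces. -/
def sumIncl {ι : Type*} [Fintype ι] (A : ι → Submodule 𝕜 X) : (∀ i, A i) →L[𝕜] X :=
  ∑ i, (A i).subtypeL ∘L ContinuousLinearMap.proj i

@[simp] lemma sumIncl_apply {ι : Type*} [Fintype ι] (A : ι → Submodule 𝕜 X) (a : ∀ i, A i) :
    sumIncl A a = ∑ i, (a i : X) := by
  simp [sumIncl]

lemma le_range_sumIncl {ι : Type*} [Fintype ι] [DecidableEq ι] (A : ι → Submodule 𝕜 X) (i : ι) :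
    A i ≤ LinearMap.range (sumIncl A : (∀ i, A i) →ₗ[𝕜] X) := by
  intro x hx
  refine ⟨Pi.single i ⟨x, hx⟩, ?_⟩
  rw [ContinuousLinearMap.coe_coe, sumIncl_apply, Finset.sum_eq_single i]
  · simp
  · intro j _ hj
    simp [Pi.single_eq_of_ne hj]
  · simp

variable {K : ℕ} {A : Fin K → Submodule 𝕜 X} {C : ℕ → Submodule 𝕜 X}

lemma antitone_of_sup_eq (hsup : ∀ i : Fin K, A i ⊔ C (i + 1) = C i) {i j : ℕ} (hij : i ≤ j)
    (hj : j ≤ K) : C j ≤ C i := by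
  induction j, hij using Nat.le_induction with
  | base => exact le_rfl
  | succ j hij ih =>
    refine le_trans ?_ (ih (by omega))
    rw [← hsup ⟨j, by omega⟩]
    exact le_sup_right

/-- Upward induction for a decreasing filtration: once the components below `i` vanish, those above
`i`, `n` and the total all lie in `C (i + 1)`, hence so does `a i`, which disjointness kills. -/
lemma component_eq_zero_of_mem (hd : ∀ i : Fin K, Disjoint (A i) (C (i + 1)))
    (hsup : ∀ i : Fin K, A i ⊔ C (i + 1) = C i) {a : ∀ i, A i} {n : X} (hn : n ∈ C K) {m : ℕ}
    (hm : m ≤ K) (h : ∑ i, (a i : X) + n ∈ C m) (i : Fin K) (hi : (i : ℕ) < m) : a i = 0 := by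
  induction hp : (i : ℕ) using Nat.strong_induction_on generalizing i with
  | _ p ih =>
    have h1 : (a i : X) =
        (∑ i, (a i : X) + n) - (∑ j ∈ Finset.univ.erase i, (a j : X) + n) := by
      rw [← Finset.add_sum_erase _ _ (Finset.mem_univ i)]
      abel
    have h2 : (a i : X) ∈ C (i + 1) := by
      rw [h1]
      refine sub_mem (antitone_of_sup_eq hsup (Nat.succ_le_of_lt hi) hm h) (add_mem
        (sum_mem fun j hj => ?_) (antitone_of_sup_eq hsup i.2 le_rfl hn))
      rcases lt_or_gt_of_ne (Fin.val_ne_of_ne (Finset.ne_of_mem_erase hj)) with hji | hji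
      · rw [ih j (by omega) j (by omega) rfl]
        exact zero_mem _
      · refine antitone_of_sup_eq hsup (Nat.succ_le_of_lt hji) j.2.le ?_
        rw [← hsup j]
        exact Submodule.mem_sup_left (a j).2
    exact Subtype.ext (Submodule.disjoint_def.1 (hd i) _ (a i).2 h2)

lemma eq_zero_of_sum_add_eq_zero (hd : ∀ i : Fin K, Disjoint (A i) (C (i + 1)))
    (hsup : ∀ i : Fin K, A i ⊔ C (i + 1) = C i) {a : ∀ i, A i} {n : X} (hn : n ∈ C K)
    (h : ∑ i, (a i : X) + n = 0) : a = 0 ∧ n = 0 := by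
  have key : ∀ i, a i = 0 := fun i =>
    component_eq_zero_of_mem hd hsup hn le_rfl (h ▸ zero_mem _) i i.2
  refine ⟨funext key, ?_⟩
  simpa [key] using h

lemma le_iSup_sup (hsup : ∀ i : Fin K, A i ⊔ C (i + 1) = C i) : C 0 ≤ (⨆ i, A i) ⊔ C K := by
  have key : ∀ j ≤ K, C 0 ≤ (⨆ i, A i) ⊔ C j := by
    intro j
    induction j with
    | zero => exact fun _ => le_sup_right
    | succ j ih =>
      intro hj
      refine (ih (by omega)).trans (sup_le le_sup_left ?_)
      rw [← hsup ⟨j, by omega⟩]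
      exact sup_le_sup_right (le_iSup A _) _
  exact key K le_rfl

lemma monotone_of_sup_eq (hsup : ∀ i : Fin K, A i ⊔ C i = C (i + 1)) {i j : ℕ} (hij : i ≤ j)
    (hj : j ≤ K) : C i ≤ C j := by
  induction j, hij using Nat.le_induction with
  | base => exact le_rfl
  | succ j hij ih =>
    refine (ih (by omega)).trans ?_
    rw [← hsup ⟨j, by omega⟩]
    exact le_sup_right

/-- The mirror argument for an increasing filtration, by downward induction from the top component.
-/
lemma component_eq_zero_of_sum_mem (hd : ∀ i : Fin K, Disjoint (A i) (C i))
    (hsup : ∀ i : Fin K, A i ⊔ C i = C (i + 1)) {a : ∀ i, A i} {m : ℕ}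
    (h : ∑ i, (a i : X) ∈ C m) (i : Fin K) (hi : m ≤ i) : a i = 0 := by
  induction hp : K - (i : ℕ) using Nat.strong_induction_on generalizing i with
  | _ p ih =>
    have h1 : (a i : X) = ∑ i, (a i : X) - ∑ j ∈ Finset.univ.erase i, (a j : X) := by
      rw [← Finset.add_sum_erase _ _ (Finset.mem_univ i)]
      abel
    have h2 : (a i : X) ∈ C i := by
      rw [h1]
      refine sub_mem (monotone_of_sup_eq hsup hi i.2.le h) (sum_mem fun j hj => ?_)
      rcases lt_or_gt_of_ne (Fin.val_ne_of_ne (Finset.ne_of_mem_erase hj)) with hji | hji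
      · refine monotone_of_sup_eq hsup (Nat.succ_le_of_lt hji) i.2.le ?_
        rw [Nat.succ_eq_add_one, ← hsup j]
        exact Submodule.mem_sup_left (a j).2
      · rw [ih (K - j) (by omega) j (by omega) rfl]
        exact zero_mem _
    exact Subtype.ext (Submodule.disjoint_def.1 (hd i) _ (a i).2 h2)

lemma eq_zero_of_sum_eq_zero (hd : ∀ i : Fin K, Disjoint (A i) (C i))
    (hsup : ∀ i : Fin K, A i ⊔ C i = C (i + 1)) {a : ∀ i, A i}
    (h : ∑ i, (a i : X) = 0) : a = 0 :=
  funext fun i =>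
    component_eq_zero_of_sum_mem hd hsup (m := 0) (h ▸ zero_mem _) i (Nat.zero_le _)

lemma le_iSup_of_sup_eq (hC : C 0 = ⊥) (hsup : ∀ i : Fin K, A i ⊔ C i = C (i + 1)) {m : ℕ}
    (hm : m ≤ K) : C m ≤ ⨆ i : {i : Fin K // (i : ℕ) < m}, A i := by
  induction m with
  | zero => simp [hC]
  | succ m ih =>
    rw [← hsup ⟨m, by omega⟩]
    refine sup_le ?_ ((ih (by omega)).trans (iSup_le fun i => ?_))
    · exact le_iSup (fun i : {i : Fin K // (i : ℕ) < m + 1} => A i)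
        ⟨⟨m, by omega⟩, Nat.lt_succ_self m⟩
    · exact le_iSup (fun i : {i : Fin K // (i : ℕ) < m + 1} => A i) ⟨i, by have := i.2; omega⟩

end Chains

/-! ### Topological splittings of the two spaces. -/

section Splitting

variable {𝕜 : Type*} [RCLike 𝕜]
  {B : Type*} [NormedAddCommGroup B] [NormedSpace 𝕜 B]
  {F : Type*} [NormedAddCommGroup F] [NormedSpace 𝕜 F]
  {L : 𝕜 → B →L[𝕜] F} {k : ℕ}

lemma rankSub_zero [CompleteSpace B] (hL : ContinuousAt L 0) : rankSub L 0 = ⊤ := by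
  refine eq_top_iff.2 fun b _ => ⟨fun _ => b, rfl, ?_⟩
  have : ContinuousAt (fun ε => L ε b) 0 := hL.clm_apply continuousAt_const
  simpa [curve] using this.norm.isBoundedUnder_le.isBigO_one 𝕜

variable (D : Decomposition L k)

lemma Decomposition.Nc_le (i : Fin (k + 1)) : D.Nc i ≤ rankSub L i := by
  rw [← D.sup_Nc i]
  exact le_sup_left

lemma Decomposition.rankSub_antitone (D : Decomposition L k) {i j : ℕ}
    (hij : i ≤ j) (hj : j ≤ k + 1) :
    rankSub L j ≤ rankSub L i :=
  antitone_of_sup_eq (A := D.Nc) D.sup_Nc hij hj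

/-- The sum map from the components of the decomposition to the space. -/
def Decomposition.incl : D.NcProd × D.N →L[𝕜] B :=
  sumIncl D.Nc ∘L ContinuousLinearMap.fst 𝕜 _ _ + D.N.subtypeL ∘L ContinuousLinearMap.snd 𝕜 _ _

lemma Decomposition.incl_apply (v : D.NcProd × D.N) :
    D.incl v = ∑ i, (v.1 i : B) + v.2 := by
  simp [Decomposition.incl]

variable [CompleteSpace B]

omit [CompleteSpace B] in
lemma Decomposition.ker_incl : LinearMap.ker (D.incl : D.NcProd × D.N →ₗ[𝕜] B) = ⊥ := by
  refine LinearMap.ker_eq_bot'.2 fun v hv => ?_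
  rw [ContinuousLinearMap.coe_coe, D.incl_apply] at hv
  have := eq_zero_of_sum_add_eq_zero D.disjoint_Nc D.sup_Nc v.2.2 hv
  exact Prod.ext this.1 (Subtype.ext this.2)

lemma Decomposition.range_incl (hL : ContinuousAt L 0) :
    LinearMap.range (D.incl : D.NcProd × D.N →ₗ[𝕜] B) = ⊤ := by
  refine eq_top_iff.2 ?_
  rw [← rankSub_zero hL]
  refine (le_iSup_sup D.sup_Nc).trans (sup_le (iSup_le fun i => ?_) fun n hn => ?_)
  · refine (le_range_sumIncl D.Nc i).trans ?_
    rintro _ ⟨a, rfl⟩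
    exact ⟨(a, 0), by simp [Decomposition.incl]⟩
  · exact ⟨(0, ⟨n, hn⟩), by simp [Decomposition.incl]⟩

/-- The splitting of the space given by the decomposition. -/
def Decomposition.splitting (hL : ContinuousAt L 0) : (D.NcProd × D.N) ≃L[𝕜] B :=
  haveI := fun i => (D.isClosed_Nc i).completeSpace_coe
  haveI : CompleteSpace D.N := D.isClosed_N.completeSpace_coe
  -- Closedness of the summands enters here: they are Banach spaces, and the open mapping theorem
  -- makes the inverse bounded.
  ContinuousLinearEquiv.ofBijective D.incl D.ker_incl (D.range_incl hL)

lemma Decomposition.splitting_apply (hL : ContinuousAt L 0) (v : D.NcProd × D.N) :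
    D.splitting hL v = ∑ i, (v.1 i : B) + v.2 := D.incl_apply v

omit [CompleteSpace B] in
lemma leadSubBelow_eq_top (hk : KSurjective L k) : leadSubBelow L (k + 1) = ⊤ :=
  eq_top_iff.2 fun y _ => hk y

omit [CompleteSpace B] in
lemma Decomposition.sup_R' (i : Fin (k + 1)) :
    D.R i ⊔ leadSubBelow L i = leadSubBelow L (i + 1) := D.sup_R i

variable [CompleteSpace F]

/-- The splitting of the target space into the spaces of leading coefficients. -/
def Decomposition.targetSplitting (hk : KSurjective L k) : (∀ i, D.R i) ≃L[𝕜] F :=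
  haveI := fun i => (D.isClosed_R i).completeSpace_coe
  ContinuousLinearEquiv.ofBijective (sumIncl D.R)
    (LinearMap.ker_eq_bot'.2 fun a ha =>
      eq_zero_of_sum_eq_zero D.disjoint_R D.sup_R' (by simpa using ha))
    (eq_top_iff.2 (by
      rw [← leadSubBelow_eq_top hk]
      exact (le_iSup_of_sup_eq rfl D.sup_R' le_rfl).trans
        (iSup_le fun i => le_range_sumIncl D.R i)))

omit [CompleteSpace B] in
lemma Decomposition.targetSplitting_apply (hk : KSurjective L k) (a : ∀ i, D.R i) :
    D.targetSplitting hk a = ∑ i, (a i : F) := sumIncl_apply D.R a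

omit [CompleteSpace B] [CompleteSpace F] in
lemma JordanChains.sumS_apply {D : Decomposition L k} (J : JordanChains D) (φ : D.NcProd) :
    J.sumS φ = ∑ i, (J.S i (φ i) : F) := by
  simp [JordanChains.sumS]

omit [CompleteSpace B] in
lemma JordanChains.sumS_isInvertible {D : Decomposition L k} (J : JordanChains D)
    (hk : KSurjective L k) : J.sumS.IsInvertible := by
  refine ⟨(ContinuousLinearEquiv.piCongrRight J.S).trans (D.targetSplitting hk), ?_⟩
  ext φ
  rw [J.sumS_apply]
  exact D.targetSplitting_apply hk _

end Splitting

/-! ### Calculus of polynomial curves and leading coefficients. -/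

section Curves

variable {𝕜 : Type*} [RCLike 𝕜]
  {B : Type*} [NormedAddCommGroup B] [NormedSpace 𝕜 B]
  {F : Type*} [NormedAddCommGroup F] [NormedSpace 𝕜 F]
  {L : 𝕜 → B →L[𝕜] F} {k : ℕ}

lemma continuous_curve (c : ℕ → B) (m : ℕ) : Continuous fun ε : 𝕜 => curve c m ε := by
  unfold curve
  fun_prop

lemma continuousAt_apply_curve (hL : ContinuousAt L 0) (c : ℕ → B) (m : ℕ) :
    ContinuousAt (fun ε : 𝕜 => L ε (curve c m ε)) 0 :=
  hL.clm_apply (continuous_curve c m).continuousAt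

lemma mem_rankSub_of_isBigO (hL : ContinuousAt L 0) {c : ℕ → B} {i : ℕ}
    (h : (fun ε : 𝕜 => L ε (curve c i ε)) =O[𝓝[≠] 0] fun ε : 𝕜 => ε ^ i) : c 0 ∈ rankSub L i :=
  ⟨c, rfl, isBigO_nhds_of_punctured (continuousAt_apply_curve hL c i)
    (continuous_pow i).continuousAt h⟩

lemma mem_leadSub_of_isBigO (hL : ContinuousAt L 0) {c : ℕ → B} {i : ℕ} {y : F}
    (h : (fun ε : 𝕜 => L ε (curve c i ε) - ε ^ i • y) =O[𝓝[≠] 0] fun ε : 𝕜 => ε ^ (i + 1)) :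
    y ∈ leadSub L i := by
  refine ⟨c, isBigO_nhds_of_punctured ((continuousAt_apply_curve hL c i).sub ?_)
    (continuous_pow _).continuousAt h⟩
  exact ((continuous_pow i).smul continuous_const).continuousAt

lemma curve_succ (c : ℕ → B) (m : ℕ) (ε : 𝕜) :
    curve c (m + 1) ε = curve c m ε + ε ^ (m + 1) • c (m + 1) :=
  Finset.sum_range_succ _ _

lemma curve_succ' (c : ℕ → B) (m : ℕ) (ε : 𝕜) :
    curve c (m + 1) ε = ε • curve (fun j => c (j + 1)) m ε + c 0 := by
  rw [curve, Finset.sum_range_succ', curve, Finset.smul_sum]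
  simp [pow_succ', smul_smul]

lemma curve_eq_of_le {c : ℕ → B} {m l : ℕ} (hml : m ≤ l) (hc : ∀ j, m < j → c j = 0) (ε : 𝕜) :
    curve c l ε = curve c m ε := by
  refine (Finset.sum_subset (Finset.range_mono (by omega)) fun j _ hj => ?_).symm
  rw [hc j (by simpa using hj), smul_zero]

/-- The last coefficient contributes only `O(ε ^ (m + 1))`, so it can be dropped. This bridges
`rankSub`, which uses curves of degree `i` at order `i`, and `leadSub`, where the error has order `i
+ 1`. -/
lemma isBigO_curve_of_succ (hL : ContinuousAt L 0) {c : ℕ → B} {m : ℕ}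
    (h : (fun ε : 𝕜 => L ε (curve c (m + 1) ε)) =O[𝓝[≠] 0] fun ε : 𝕜 => ε ^ (m + 1)) :
    (fun ε : 𝕜 => L ε (curve c m ε)) =O[𝓝[≠] 0] fun ε : 𝕜 => ε ^ (m + 1) := by
  have h1 : (fun ε : 𝕜 => L ε (c (m + 1))) =O[𝓝[≠] 0] fun ε : 𝕜 => ε ^ 0 := by
    have : ContinuousAt (fun ε => L ε (c (m + 1))) 0 := hL.clm_apply continuousAt_const
    simpa using (this.norm.isBoundedUnder_le.isBigO_one 𝕜).mono nhdsWithin_le_nhds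
  refine (h.sub (by simpa using smul_isBigO (d := m + 1) h1)).congr_left fun ε => ?_
  rw [curve_succ, map_add, map_smul, add_sub_cancel_right]

/-- The difference of two curves with the same starting point is divisible by `ε`, and the quotient
has leading coefficient `y - y'` at order `m - 1`. Thus a starting point determines its leading
coefficient modulo those of lower order. -/
lemma sub_mem_leadSubBelow (hL : ContinuousAt L 0) {c c' : ℕ → B} (h0 : c 0 = c' 0) {m : ℕ}
    {y y' : F}
    (h : (fun ε : 𝕜 => L ε (curve c m ε) - ε ^ m • y) =O[𝓝[≠] 0] fun ε : 𝕜 => ε ^ (m + 1))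
    (h' : (fun ε : 𝕜 => L ε (curve c' m ε) - ε ^ m • y') =O[𝓝[≠] 0] fun ε : 𝕜 => ε ^ (m + 1)) :
    y - y' ∈ leadSubBelow L m := by
  have hd := h.sub h'
  cases m with
  | zero =>
    simp only [curve, zero_add, Finset.range_one, Finset.sum_singleton, pow_zero, one_smul, h0,
      sub_sub_sub_cancel_left] at hd
    have := eq_zero_of_isBigO_pow_succ (f := fun _ : 𝕜 => y' - y) continuousAt_const
      (m := 0) (by simpa using hd)
    rw [← neg_sub, this, neg_zero]
    exact zero_mem _
  | succ m =>
    refine mem_leadSub_of_isBigO hL (c := fun j => c (j + 1) - c' (j + 1)) ?_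
    refine isBigO_of_smul_isBigO (d := 1) (hd.congr_left fun ε => ?_)
    have : curve (fun j => c (j + 1) - c' (j + 1)) m ε =
        curve (fun j => c (j + 1)) m ε - curve (fun j => c' (j + 1)) m ε := by
      simp [curve, smul_sub]
    rw [curve_succ', curve_succ', this, h0, pow_succ']
    simp only [map_add, map_sub, map_smul, smul_sub, pow_one, smul_smul]
    module

lemma sum_shift_eq {a : ℕ → B} {d l k : ℕ} (ha : ∀ i, l < i → a i = 0) (hdl : d + l ≤ k) (ε : 𝕜) :
    ∑ j ∈ Finset.range (k + 1), ε ^ j • (if d ≤ j then a (j - d) else 0) =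
      ε ^ d • ∑ j ∈ Finset.range (k + 1), ε ^ j • a j := by
  obtain ⟨r, hr⟩ : ∃ r, k + 1 = d + r := ⟨k + 1 - d, by omega⟩
  have h1 : ∑ j ∈ Finset.range (k + 1), ε ^ j • a j = ∑ j ∈ Finset.range r, ε ^ j • a j := by
    refine (Finset.sum_subset (Finset.range_mono (by omega)) fun j _ hj => ?_).symm
    rw [ha j (by simp at hj; omega), smul_zero]
  rw [h1, hr, Finset.sum_range_add, Finset.sum_eq_zero, zero_add, Finset.smul_sum]
  · refine Finset.sum_congr rfl fun j _ => ?_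
    simp [pow_add, smul_smul]
  · intro j hj
    rw [if_neg (by simpa using hj), smul_zero]

end Curves

/-! ### Inductive construction of the Jordan chains. -/

section Existence

variable {𝕜 : Type*} [RCLike 𝕜]
  {B : Type*} [NormedAddCommGroup B] [NormedSpace 𝕜 B] [CompleteSpace B]
  {F : Type*} [NormedAddCommGroup F] [NormedSpace 𝕜 F] [CompleteSpace F]
  {L : 𝕜 → B →L[𝕜] F} {k : ℕ} (D : Decomposition L k)

include D in
omit [CompleteSpace F] in
-- Precomposing with `π` extends corrections from `rankSub L m` to bounded operators on `B` that
-- vanish on the earlier complements, so chains already built stay unchanged.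
lemma Decomposition.exists_projection (hL : ContinuousAt L 0) {m : ℕ} (hm : m ≤ k + 1) :
    ∃ π : B →L[𝕜] B, (∀ b, π b ∈ rankSub L m) ∧ (∀ b ∈ rankSub L m, π b = b) ∧
      ∀ i : Fin (k + 1), (i : ℕ) < m → ∀ b ∈ D.Nc i, π b = 0 := by
  set e := D.splitting hL
  set Z : D.NcProd × D.N →L[𝕜] D.NcProd × D.N :=
    (ContinuousLinearMap.pi fun i : Fin (k + 1) => if (i : ℕ) < m then 0 else
      ContinuousLinearMap.proj i ∘L ContinuousLinearMap.fst 𝕜 D.NcProd D.N).prod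
      (ContinuousLinearMap.snd 𝕜 D.NcProd D.N) with hZ
  have hZ1 : ∀ v i, (Z v).1 i = if (i : ℕ) < m then 0 else v.1 i := by
    intro v i
    simp only [hZ, ContinuousLinearMap.prod_apply, ContinuousLinearMap.pi_apply]
    split_ifs <;> rfl
  have hZ2 : ∀ v, (Z v).2 = v.2 := fun v => rfl
  refine ⟨(e : D.NcProd × D.N →L[𝕜] B) ∘L Z ∘L (e.symm : B →L[𝕜] D.NcProd × D.N), ?_, ?_, ?_⟩
  · intro b
    show e (Z (e.symm b)) ∈ _
    rw [D.splitting_apply hL]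
    refine add_mem (sum_mem fun i _ => ?_) (D.rankSub_antitone hm le_rfl (Z (e.symm b)).2.2)
    rw [hZ1]
    split_ifs with h
    · exact zero_mem _
    · exact D.rankSub_antitone (by omega) i.2.le (D.Nc_le i (e.symm b |>.1 i).2)
  · intro b hb
    show e (Z (e.symm b)) = b
    have h1 : Z (e.symm b) = e.symm b := by
      refine Prod.ext (funext fun i => ?_) (hZ2 _)
      rw [hZ1]
      split_ifs with h
      · refine (component_eq_zero_of_mem (n := ((e.symm b).2 : B)) D.disjoint_Nc D.sup_Nc
          (e.symm b).2.2 hm ?_ i h).symm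
        rw [← D.splitting_apply hL]
        simpa [e] using hb
      · rfl
    rw [h1, e.apply_symm_apply]
  · intro i hi b hb
    show e (Z (e.symm b)) = 0
    have h1 : e.symm b = (Pi.single i ⟨b, hb⟩, 0) := by
      rw [e.symm_apply_eq, D.splitting_apply hL, Finset.sum_eq_single i]
      · simp
      · intro j _ hj
        simp [Pi.single_eq_of_ne hj]
      · simp
    have h2 : Z (e.symm b) = 0 := by
      refine Prod.ext (funext fun j => ?_) (by rw [hZ2, h1]; rfl)
      rw [hZ1, h1]
      split_ifs with h
      · rfl
      · have : j ≠ i := by rintro rfl; exact h hi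
        simp [Pi.single_eq_of_ne this]
    rw [h2, map_zero]

/-- Jordan chains constructed up to order `m`. -/
structure PartialChains (m : ℕ) where
  φ : ℕ → B →L[𝕜] B
  φ_zero : φ 0 = ContinuousLinearMap.id 𝕜 B
  φ_mem : ∀ j, 1 ≤ j → ∀ b : B, φ j b ∈ ⨆ i : {i : Fin (k + 1) // (i : ℕ) + j < m}, D.Nc i
  -- A chain starting in `Nc l` has degree at most `l`; its shift by `ε ^ (m - l)` then has degree
  -- at most `m`.
  φ_mem' : ∀ l : Fin (k + 1), (l : ℕ) < m → ∀ b ∈ D.Nc l, ∀ j, 1 ≤ j →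
    φ j b ∈ ⨆ i : {i : Fin (k + 1) // (i : ℕ) + j ≤ l}, D.Nc i
  -- Only the values at `i < m` matter; the others are placeholders, initially `0`.
  S : ∀ i : Fin (k + 1), D.Nc i →L[𝕜] D.R i
  bijective : ∀ i : Fin (k + 1), (i : ℕ) < m → Function.Bijective (S i)
  lead : ∀ i : Fin (k + 1), (i : ℕ) < m → ∀ n : D.Nc i,
    (fun ε : 𝕜 => L ε (curve (fun j => φ j n) k ε) - ε ^ (i : ℕ) • (S i n : F))
      =O[𝓝[≠] 0] fun ε : 𝕜 => ε ^ ((i : ℕ) + 1)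
  kernel : ∀ n ∈ rankSub L m,
    (fun ε : 𝕜 => L ε (curve (fun j => φ j n) k ε)) =O[𝓝[≠] 0] fun ε : 𝕜 => ε ^ m

omit [CompleteSpace B] [CompleteSpace F] in
lemma iSup_Nc_mono {p q : Fin (k + 1) → Prop} (h : ∀ i, p i → q i) :
    ⨆ i : {i // p i}, D.Nc i ≤ ⨆ i : {i // q i}, D.Nc i :=
  iSup_le fun i => le_iSup (fun i : {i // q i} => D.Nc i) ⟨i, h _ i.2⟩

omit [CompleteSpace B] [CompleteSpace F] in
lemma iSup_Nc_eq_bot {p : Fin (k + 1) → Prop} (h : ∀ i, ¬ p i) :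
    ⨆ i : {i // p i}, D.Nc i = ⊥ := by
  have : IsEmpty {i // p i} := ⟨fun i => h _ i.2⟩
  exact iSup_of_empty _

variable {D}

omit [CompleteSpace B] in
/-- The coefficient of order `m` of `L(ε) p(ε)` on the elements of rank at least `m`. -/
lemma PartialChains.exists_coefficient {m : ℕ} (P : PartialChains D m)
    (hL : ContDiffAt 𝕜 (m + 1 : ℕ) L 0) :
    ∃ T : B →L[𝕜] F, ∀ n ∈ rankSub L m,
      (fun ε : 𝕜 => L ε (curve (fun j => P.φ j n) k ε) - ε ^ m • T n)
        =O[𝓝[≠] 0] fun ε : 𝕜 => ε ^ (m + 1) := by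
  have hp : ContDiffAt 𝕜 (m + 1 : ℕ)
      (fun ε : 𝕜 => ∑ j ∈ Finset.range (k + 1), ε ^ j • P.φ j) 0 := by fun_prop
  obtain ⟨T, hT⟩ := NewtonLemma.exists_coefficient m (hL.clm_comp hp)
  have h1 : ∀ (ε : 𝕜) (n : B), (L ε ∘L ∑ j ∈ Finset.range (k + 1), ε ^ j • P.φ j) n =
      L ε (curve (fun j => P.φ j n) k ε) := by
    intro ε n
    simp [curve]
  refine ⟨T, fun n hn => ?_⟩
  have h2 := hT n
  simp only [h1] at h2
  exact h2 (P.kernel n hn)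

/-- The coefficients of `p(ε) (id - ∑ l, ε ^ (m - l) Q l)`. -/
def PartialChains.nextφ {m : ℕ} (P : PartialChains D m) (Q : Fin (k + 1) → B →L[𝕜] B) (j : ℕ) :
    B →L[𝕜] B :=
  P.φ j - ∑ l : Fin (k + 1), if m - (l : ℕ) ≤ j then P.φ (j - (m - l)) ∘L Q l else 0

omit [CompleteSpace B] [CompleteSpace F] in
lemma PartialChains.nextφ_apply {m : ℕ} (P : PartialChains D m) (Q : Fin (k + 1) → B →L[𝕜] B)
    (j : ℕ) (b : B) : P.nextφ Q j b =
      P.φ j b - ∑ l : Fin (k + 1), if m - (l : ℕ) ≤ j then P.φ (j - (m - l)) (Q l b) else 0 := by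
  simp only [nextφ, _root_.sub_apply, _root_.sum_apply]
  congr 1
  refine Finset.sum_congr rfl fun l _ => ?_
  split_ifs <;> rfl

omit [CompleteSpace B] [CompleteSpace F] in
lemma PartialChains.curve_nextφ {m : ℕ} (hm : m ≤ k) (P : PartialChains D m)
    {Q : Fin (k + 1) → B →L[𝕜] B} (hQ : ∀ l b, Q l b ∈ D.Nc l)
    (hQ0 : ∀ l : Fin (k + 1), m ≤ l → Q l = 0) (b : B) (ε : 𝕜) :
    curve (fun j => P.nextφ Q j b) k ε = curve (fun j => P.φ j b) k ε -
      ∑ l : Fin (k + 1), ε ^ (m - (l : ℕ)) • curve (fun j => P.φ j (Q l b)) k ε := by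
  simp only [curve, P.nextφ_apply, smul_sub, Finset.sum_sub_distrib, Finset.smul_sum]
  rw [Finset.sum_comm]
  congr 1
  refine Finset.sum_congr rfl fun l _ => ?_
  rw [← Finset.smul_sum]
  rcases le_or_gt m l with h | h
  · simp [hQ0 l h]
  -- The shifted chain has degree at most `(m - l) + l = m ≤ k`, so truncation at degree `k` loses
  -- nothing.
  · refine sum_shift_eq (a := fun j => P.φ j (Q l b)) (d := m - l) (l := l) (fun i hi => ?_)
      (by omega) ε
    have := P.φ_mem' l h _ (hQ l b) i (by omega)
    rwa [iSup_Nc_eq_bot D (fun i' h' => by omega), Submodule.mem_bot] at this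

omit [CompleteSpace B] [CompleteSpace F] in
lemma PartialChains.nextφ_zero {m : ℕ} (P : PartialChains D m)
    {Q : Fin (k + 1) → B →L[𝕜] B} (hQ0 : ∀ l : Fin (k + 1), m ≤ l → Q l = 0) :
    P.nextφ Q 0 = ContinuousLinearMap.id 𝕜 B := by
  rw [nextφ, P.φ_zero, Finset.sum_eq_zero, sub_zero]
  intro l _
  split_ifs with h
  · simp [hQ0 l (by omega)]
  · rfl

omit [CompleteSpace B] [CompleteSpace F] in
lemma PartialChains.nextφ_mem {m : ℕ} (P : PartialChains D m)
    {Q : Fin (k + 1) → B →L[𝕜] B} (hQ : ∀ l b, Q l b ∈ D.Nc l)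
    (hQ0 : ∀ l : Fin (k + 1), m ≤ l → Q l = 0) {j : ℕ} (hj : 1 ≤ j) (b : B) :
    P.nextφ Q j b ∈ ⨆ i : {i : Fin (k + 1) // (i : ℕ) + j < m + 1}, D.Nc i := by
  rw [P.nextφ_apply]
  refine sub_mem (iSup_Nc_mono D (fun i h => by omega) (P.φ_mem j hj b)) (sum_mem fun l _ => ?_)
  rcases le_or_gt m l with h | h
  · simp [hQ0 l h]
  split_ifs with h1
  · rcases Nat.eq_zero_or_pos (j - (m - l)) with h2 | h2
    · rw [h2, P.φ_zero]
      exact Submodule.mem_iSup_of_mem (p := fun i : {i : Fin (k + 1) // (i : ℕ) + j < m + 1} =>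
        D.Nc i) ⟨l, by omega⟩ (hQ l b)
    · exact iSup_Nc_mono D (fun i h => by omega) (P.φ_mem' l h _ (hQ l b) _ h2)
  · exact zero_mem _

/-- On elements of rank at least `m` the coefficient `T n` of order `m` is a leading coefficient, so
it splits into components `t l n` with `l ≤ m`. For `l < m` the component is `S l` of some element
of `Nc l`; subtracting `ε ^ (m - l)` times the chain of that element cancels it. What survives is `t
m n`, which is zero on rank `m + 1` and bijective from `Nc m` to `R m`. -/
lemma PartialChains.exists_succ (hL : ContDiffAt 𝕜 (k + 1 : ℕ) L 0) (hk : KSurjective L k) {m : ℕ}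
    (hm : m ≤ k) (P : PartialChains D m) : Nonempty (PartialChains D (m + 1)) := by
  have hLc : ContinuousAt L 0 := hL.continuousAt
  obtain ⟨π, hπ1, hπ2, hπ3⟩ := D.exists_projection hLc (m := m) (by omega)
  obtain ⟨T, hT⟩ := P.exists_coefficient (hL.of_le (by exact_mod_cast (by omega : m + 1 ≤ k + 1)))
  set e := D.targetSplitting hk with he
  have hinv : ∀ l : Fin (k + 1), ∃ g : D.R l →L[𝕜] D.Nc l, (l : ℕ) < m → ∀ y, P.S l (g y) = y := by
    intro l
    by_cases h : (l : ℕ) < m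
    · have := (D.isClosed_R l).completeSpace_coe
      have := (D.isClosed_Nc l).completeSpace_coe
      have hb := P.bijective l h
      let E := ContinuousLinearEquiv.ofBijective (P.S l) (LinearMap.ker_eq_bot.2 hb.1)
        (LinearMap.range_eq_top.2 hb.2)
      exact ⟨(E.symm : D.R l →L[𝕜] D.Nc l), fun _ y => E.apply_symm_apply y⟩
    · exact ⟨0, fun h' => absurd h' h⟩
  choose g hg using hinv
  set t : ∀ l : Fin (k + 1), B →L[𝕜] D.R l := fun l =>
    ContinuousLinearMap.proj l ∘L (e.symm : F →L[𝕜] ∀ i, D.R i) ∘L T with ht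
  set Q : Fin (k + 1) → B →L[𝕜] B := fun l =>
    if (l : ℕ) < m then (D.Nc l).subtypeL ∘L g l ∘L t l ∘L π else 0 with hQdef
  have hQ0 : ∀ l : Fin (k + 1), m ≤ l → Q l = 0 := fun l h => if_neg (by omega)
  have hQlt : ∀ l : Fin (k + 1), (l : ℕ) < m → ∀ b, Q l b = g l (t l (π b)) := by
    intro l h b
    simp only [hQdef, if_pos h]
    rfl
  have hQ : ∀ l b, Q l b ∈ D.Nc l := by
    intro l b
    rcases le_or_gt m l with h | h
    · rw [hQ0 l h]
      exact zero_mem _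
    · rw [hQlt l h]
      exact Subtype.coe_prop _
  have hQker : ∀ i : Fin (k + 1), (i : ℕ) < m → ∀ b ∈ D.Nc i, ∀ l, Q l b = 0 := by
    intro i hi b hb l
    rcases le_or_gt m l with h | h
    · rw [hQ0 l h]
      rfl
    · rw [hQlt l h, hπ3 i hi b hb]
      simp
  have hnext : ∀ i : Fin (k + 1), (i : ℕ) < m → ∀ b ∈ D.Nc i, ∀ j, P.nextφ Q j b = P.φ j b := by
    intro i hi b hb j
    rw [P.nextφ_apply, Finset.sum_eq_zero, sub_zero]
    intro l _
    rw [hQker i hi b hb l, map_zero, ite_self]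
  have hmem : ∀ j, 1 ≤ j → ∀ b, P.nextφ Q j b ∈
      ⨆ i : {i : Fin (k + 1) // (i : ℕ) + j < m + 1}, D.Nc i :=
    fun j hj b => P.nextφ_mem hQ hQ0 hj b
  have hzero : ∀ b j, m < j → P.nextφ Q j b = 0 := by
    intro b j hj
    have := hmem j (by omega) b
    rwa [iSup_Nc_eq_bot D (fun i h => by omega), Submodule.mem_bot] at this
  let M : Fin (k + 1) := ⟨m, by omega⟩
  have hTsum : ∀ n ∈ rankSub L m, T n = ∑ l, (t l n : F) ∧
      ∀ l : Fin (k + 1), m < l → t l n = 0 := by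
    intro n hn
    have h1 : T n = ∑ l, (t l n : F) := by
      rw [← e.apply_symm_apply (T n), he, D.targetSplitting_apply hk]
      rfl
    have h2 : T n ∈ leadSubBelow L (m + 1) := by
      refine mem_leadSub_of_isBigO hLc (c := fun j => P.φ j n) ((hT n hn).congr_left fun ε => ?_)
      rw [curve_eq_of_le hm fun j hj => ?_]
      have := P.φ_mem j (by omega) n
      rwa [iSup_Nc_eq_bot D (fun i h => by omega), Submodule.mem_bot] at this
    refine ⟨h1, fun l hl => ?_⟩
    exact component_eq_zero_of_sum_mem (a := fun l => t l n) D.disjoint_R D.sup_R'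
      (h1 ▸ h2) l hl
  have hlead : ∀ n ∈ rankSub L m,
      (fun ε : 𝕜 => L ε (curve (fun j => P.nextφ Q j n) k ε) - ε ^ m • (t M n : F))
        =O[𝓝[≠] 0] fun ε : 𝕜 => ε ^ (m + 1) := by
    intro n hn
    obtain ⟨hT1, hT2⟩ := hTsum n hn
    -- The `if` term restores the component at `M`, the only one that no correction removes; above
    -- `m` both `Q l` and `t l n` vanish.
    have h1 : ∀ l : Fin (k + 1), (fun ε : 𝕜 => ε ^ (m - (l : ℕ)) •
        L ε (curve (fun j => P.φ j (Q l n)) k ε) - ε ^ m • (t l n : F) +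
        (if l = M then ε ^ m • (t l n : F) else 0)) =O[𝓝[≠] 0] fun ε : 𝕜 => ε ^ (m + 1) := by
      intro l
      rcases lt_trichotomy (l : ℕ) m with h | h | h
      · have h2 := smul_isBigO (d := m - l) (P.lead l h (g l (t l n)))
        rw [show (l : ℕ) + 1 + (m - l) = m + 1 by omega] at h2
        refine h2.congr_left fun ε => ?_
        rw [if_neg (by rintro rfl; exact lt_irrefl _ h), add_zero, hQlt l h, hπ2 n hn, hg l h,
          smul_sub, smul_smul, ← pow_add, show m - (l : ℕ) + l = m by omega]
      · have hlM : l = M := Fin.ext h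
        refine (isBigO_zero _ _).congr_left fun ε => ?_
        rw [if_pos hlM, hQ0 l h.ge]
        simp [curve]
      · refine (isBigO_zero _ _).congr_left fun ε => ?_
        rw [if_neg (by rintro rfl; exact lt_irrefl _ h), hQ0 l h.le, hT2 l h]
        simp [curve]
    refine ((hT n hn).sub (IsBigO.sum fun l (_ : l ∈ Finset.univ) => h1 l)).congr_left fun ε => ?_
    rw [P.curve_nextφ hm hQ hQ0, map_sub, map_sum, Finset.sum_apply, Finset.sum_add_distrib,
      Finset.sum_sub_distrib, Finset.sum_ite_eq' Finset.univ M, if_pos (Finset.mem_univ _),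
      ← Finset.smul_sum, ← hT1]
    simp only [map_smul]
    abel
  have hcoeff0 : ∀ n, P.nextφ Q 0 n = n := fun n => by rw [P.nextφ_zero hQ0]; rfl
  -- A curve witnessing rank `m + 1` and the corrected chain start at the same `n`, so `t M n` is a
  -- lower leading coefficient; it also lies in `R M`.
  have hker : ∀ n ∈ rankSub L (m + 1), t M n = 0 := by
    intro n hn
    have hn' : n ∈ rankSub L m := D.rankSub_antitone (Nat.le_succ m) (by omega) hn
    obtain ⟨c, hc0, hc⟩ := hn
    have h1 := hlead n hn'
    have h2 := isBigO_curve_of_succ hLc (hc.mono nhdsWithin_le_nhds)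
    have h3 : (t M n : F) - 0 ∈ leadSubBelow L m := by
      refine sub_mem_leadSubBelow hLc (c := fun j => P.nextφ Q j n) (c' := c) ?_ ?_
        (by simpa using h2)
      · rw [hcoeff0, hc0]
      · refine h1.congr_left fun ε => ?_
        rw [curve_eq_of_le hm (hzero n)]
    rw [sub_zero] at h3
    exact Subtype.ext (Submodule.disjoint_def.1 (D.disjoint_R M) _ (t M n).2 h3)
  set σ : D.Nc M →L[𝕜] D.R M := t M ∘L (D.Nc M).subtypeL with hσ
  have hσ_apply : ∀ n : D.Nc M, σ n = t M n := fun n => rfl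
  have hσbij : Function.Bijective σ := by
    constructor
    · refine (injective_iff_map_eq_zero σ).2 fun n hn => ?_
      have h1 := hlead n (D.Nc_le M n.2)
      rw [← hσ_apply, hn] at h1
      have h2 : (fun j => P.nextφ Q j (n : B)) 0 ∈ rankSub L (m + 1) := by
        refine mem_rankSub_of_isBigO hLc (c := fun j => P.nextφ Q j (n : B))
          (h1.congr_left fun ε => ?_)
        -- Membership in `rankSub L (m + 1)` asks for a curve of degree `m + 1`; its top coefficient
        -- is zero here.
        rw [curve_eq_of_le hm (hzero n), curve_eq_of_le (Nat.le_succ m) (hzero n)]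
        simp
      simp only [hcoeff0] at h2
      exact Subtype.ext (Submodule.disjoint_def.1 (D.disjoint_Nc M) _ n.2 h2)
    -- A curve with leading coefficient `y` starts at a `c 0` of rank at least `m`, and `t M (c 0) =
    -- y` by uniqueness modulo lower order. The part of `c 0` of rank `m + 1` is then dropped by
    -- `hker`.
    · intro y
      have hy : (y : F) ∈ leadSub L m := by
        rw [← D.sup_R M]
        exact Submodule.mem_sup_left y.2
      obtain ⟨c, hc⟩ := hy
      have hc' := hc.mono (nhdsWithin_le_nhds (s := {0}ᶜ))
      have hb : c 0 ∈ rankSub L m := by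
        refine mem_rankSub_of_isBigO hLc ?_
        have h1 : (fun ε : 𝕜 => ε ^ (m + 1)) =O[𝓝[≠] 0] fun ε : 𝕜 => ε ^ m := by
          have h0 : (fun ε : 𝕜 => ε) =O[𝓝 0] fun _ => (1 : 𝕜) :=
            (continuousAt_id (x := (0 : 𝕜))).norm.isBoundedUnder_le.isBigO_one 𝕜
          simpa [pow_succ] using (isBigO_refl (fun ε : 𝕜 => ε ^ m) (𝓝[≠] 0)).mul
            (h0.mono nhdsWithin_le_nhds)
        have h2 : (fun ε : 𝕜 => ε ^ m • (y : F)) =O[𝓝[≠] 0] fun ε : 𝕜 => ε ^ m := by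
          have := (isBigO_refl (fun ε : 𝕜 => ε ^ m) (𝓝[≠] 0)).smul
            (isBigO_const_const (y : F) (one_ne_zero (α := 𝕜)) (𝓝[≠] 0))
          simpa using this
        simpa using (hc'.trans h1).add h2
      have h3 : (y : F) - t M (c 0) ∈ leadSubBelow L m := by
        refine sub_mem_leadSubBelow hLc (c := c) (c' := fun j => P.nextφ Q j (c 0)) ?_ hc' ?_
        · rw [hcoeff0]
        · refine (hlead _ hb).congr_left fun ε => ?_
          rw [curve_eq_of_le hm (hzero _)]
      have h4 : y = t M (c 0) := by
        rw [← sub_eq_zero]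
        exact Subtype.ext (Submodule.disjoint_def.1 (D.disjoint_R M) _ (y - t M (c 0)).2 h3)
      have hb' := hb
      rw [show m = (M : ℕ) from rfl, ← D.sup_Nc M] at hb'
      obtain ⟨b₁, hb₁, b₂, hb₂, hbb⟩ := Submodule.mem_sup.1 hb'
      refine ⟨⟨b₁, hb₁⟩, ?_⟩
      rw [hσ_apply, h4, ← hbb, map_add, hker b₂ hb₂, add_zero]
  refine ⟨⟨P.nextφ Q, P.nextφ_zero hQ0, hmem, ?_, Function.update P.S M σ, ?_, ?_, ?_⟩⟩
  · intro l hl b hb j hj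
    rcases Nat.lt_succ_iff_lt_or_eq.1 hl with h | h
    · rw [hnext l h b hb]
      exact P.φ_mem' l h b hb j hj
    · exact iSup_Nc_mono D (fun i h => by omega) (hmem j hj b)
  · intro i hi
    by_cases h : i = M
    · subst h
      rwa [Function.update_self]
    · rw [Function.update_of_ne h]
      refine P.bijective i ?_
      have : (i : ℕ) ≠ m := fun h' => h (Fin.ext h')
      omega
  · intro i hi n
    by_cases h : i = M
    · subst h
      rw [Function.update_self]
      exact hlead n (D.Nc_le M n.2)
    · have hi' : (i : ℕ) < m := by
        have : (i : ℕ) ≠ m := fun h' => h (Fin.ext h')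
        omega
      rw [Function.update_of_ne h]
      simp only [hnext i hi' n n.2]
      exact P.lead i hi' n
  · intro n hn
    have h1 := hlead n (D.rankSub_antitone (Nat.le_succ m) (by omega) hn)
    simpa [hker n hn] using h1

lemma exists_jordanChains (hL : ContDiffAt 𝕜 (k + 1 : ℕ) L 0) (hk : KSurjective L k)
    (D : Decomposition L k) : Nonempty (JordanChains D) := by
  have hLc : ContinuousAt L 0 := hL.continuousAt
  have key : ∀ m ≤ k + 1, Nonempty (PartialChains D m) := by
    intro m
    induction m with
    | zero =>
      intro _
      refine ⟨⟨fun j => if j = 0 then ContinuousLinearMap.id 𝕜 B else 0, if_pos rfl, ?_, ?_, 0,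
        ?_, ?_, ?_⟩⟩
      · intro j hj b
        rw [if_neg (by omega)]
        exact zero_mem _
      · intro l hl
        omega
      · intro l hl
        omega
      · intro l hl
        omega
      · intro n _
        simpa using ((continuousAt_apply_curve hLc _ k).norm.isBoundedUnder_le.isBigO_one 𝕜).mono
          nhdsWithin_le_nhds
    | succ m ih =>
      intro hm
      obtain ⟨P⟩ := ih (by omega)
      exact P.exists_succ hL hk (by omega)
  obtain ⟨P⟩ := key (k + 1) le_rfl
  have hpol : ∀ (ε : 𝕜) (n : B), (∑ j ∈ Finset.range (k + 1), ε ^ j • P.φ j) n =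
      curve (fun j => P.φ j n) k ε := by
    intro ε n
    simp [curve]
  refine ⟨⟨P.φ, P.φ_zero, ?_, fun i => ?_, ?_, ?_⟩⟩
  · intro j hj _ b
    exact iSup_Nc_mono D (fun i h => Nat.lt_succ_iff.1 h) (P.φ_mem j hj b)
  · have := (D.isClosed_R i).completeSpace_coe
    have := (D.isClosed_Nc i).completeSpace_coe
    exact ContinuousLinearEquiv.ofBijective (P.S i) (LinearMap.ker_eq_bot.2 (P.bijective i i.2).1)
        (LinearMap.range_eq_top.2 (P.bijective i i.2).2)
  · intro i n
    simp only [hpol]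
    refine isBigO_nhds_of_punctured ((continuousAt_apply_curve hLc _ k).sub ?_)
      (continuous_pow _).continuousAt (P.lead i i.2 n)
    exact ((continuous_pow _).smul continuous_const).continuousAt
  · intro n
    simp only [hpol]
    exact isBigO_nhds_of_punctured (continuousAt_apply_curve hLc _ k)
      (continuous_pow _).continuousAt (P.kernel n n.2)

end Existence

/-! ### Weights that balance the orders of all components. -/

section Weight

variable {𝕜 : Type*} [RCLike 𝕜]
  {B : Type*} [NormedAddCommGroup B] [NormedSpace 𝕜 B]
  {F : Type*} [NormedAddCommGroup F] [NormedSpace 𝕜 F]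

lemma contDiff_sum_pow_smul_add {X Y ι : Type*} [NormedAddCommGroup X] [NormedSpace 𝕜 X]
    [NormedAddCommGroup Y] [NormedSpace 𝕜 Y] [Fintype ι] {n : WithTop ℕ∞} (d : ι → ℕ)
    (c : ι → X →L[𝕜] Y) (c' : X →L[𝕜] Y) :
    ContDiff 𝕜 n fun ε : 𝕜 => ∑ i, ε ^ d i • c i + c' :=
  (ContDiff.sum fun _ _ => (contDiff_id.pow _).smul contDiff_const).add contDiff_const

variable {L : 𝕜 → B →L[𝕜] F} {k : ℕ}

/-- The weighted sum `(ψ, n) ↦ ε ^ k ψ 0 + ε ^ (k - 1) ψ 1 + ... + ψ k + n`. -/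
def Decomposition.weight (D : Decomposition L k) (ε : 𝕜) : D.NcProd × D.N →L[𝕜] B :=
  ∑ i : Fin (k + 1), ε ^ (k - (i : ℕ)) • ((D.Nc i).subtypeL ∘L
    ContinuousLinearMap.proj i ∘L ContinuousLinearMap.fst 𝕜 D.NcProd D.N) +
  D.N.subtypeL ∘L ContinuousLinearMap.snd 𝕜 D.NcProd D.N

variable (D : Decomposition L k)

lemma Decomposition.weight_apply (ε : 𝕜) (v : D.NcProd × D.N) :
    D.weight ε v = ∑ i : Fin (k + 1), ε ^ (k - (i : ℕ)) • (v.1 i : B) + (v.2 : B) := by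
  simp [Decomposition.weight]

lemma Decomposition.contDiff_weight {n : WithTop ℕ∞} : ContDiff 𝕜 n D.weight := by
  exact contDiff_sum_pow_smul_add _ _ _

lemma Decomposition.weight_zero (v : D.NcProd × D.N) :
    D.weight 0 v = (v.1 (Fin.last k) : B) + (v.2 : B) := by
  rw [D.weight_apply, Finset.sum_eq_single (Fin.last k)]
  · simp
  · intro i _ hi
    have : k - (i : ℕ) ≠ 0 := by
      have := Fin.val_lt_last hi
      omega
    rw [zero_pow this, zero_smul]
  · simp

lemma Decomposition.norm_weight_le {ε : 𝕜} (hε : ‖ε‖ ≤ 1) (v : D.NcProd × D.N) :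
    ‖D.weight ε v‖ ≤ (k + 2) * ‖v‖ := by
  rw [D.weight_apply]
  have h1 : ‖∑ i : Fin (k + 1), ε ^ (k - (i : ℕ)) • (v.1 i : B)‖ ≤ (k + 1) * ‖v‖ := by
    refine (norm_sum_le _ _).trans ?_
    refine (Finset.sum_le_sum (g := fun _ => ‖v‖) fun i _ => ?_).trans (by simp)
    rw [norm_smul, norm_pow]
    refine (mul_le_of_le_one_left (norm_nonneg _) (pow_le_one₀ (norm_nonneg _) hε)).trans ?_
    exact (norm_le_pi_norm v.1 i).trans (norm_fst_le v)
  have h2 : ‖(v.2 : B)‖ ≤ ‖v‖ := norm_snd_le v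
  refine (norm_add_le _ _).trans ?_
  linarith

/-- For `ε ≠ 0` each complement is merely rescaled by a unit, so the weight is the splitting
composed with an isomorphism. -/
lemma Decomposition.exists_equiv_weight [CompleteSpace B] (hL : ContinuousAt L 0) {ε : 𝕜}
    (hε : ε ≠ 0) : ∃ W : (D.NcProd × D.N) ≃L[𝕜] B, ∀ v, W v = D.weight ε v := by
  let Z : D.NcProd ≃L[𝕜] D.NcProd := ContinuousLinearEquiv.piCongrRight fun i : Fin (k + 1) =>
    ContinuousLinearEquiv.smulLeft (Units.mk0 (ε ^ (k - (i : ℕ))) (pow_ne_zero _ hε))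
  refine ⟨(Z.prodCongr (.refl 𝕜 D.N)).trans (D.splitting hL), fun v => ?_⟩
  rw [ContinuousLinearEquiv.trans_apply, D.splitting_apply hL, D.weight_apply]
  rfl

variable {D} (J : JordanChains D)

lemma JordanChains.contDiff_p {n : WithTop ℕ∞} : ContDiff 𝕜 n J.p := by
  unfold JordanChains.p
  fun_prop

lemma JordanChains.p_zero : J.p 0 = ContinuousLinearMap.id 𝕜 B := by
  rw [JordanChains.p, Finset.sum_range_succ', Finset.sum_eq_zero]
  · simp [J.φ_zero]
  · simp

lemma JordanChains.coneMap_eq (z : 𝕜 → B) (ψ : 𝕜 → D.NcProd × D.N → D.NcProd) (ε : 𝕜)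
    (v : D.NcProd × D.N) :
    J.coneMap z ψ ε v = z ε + ε ^ k • J.p ε (D.weight ε (ψ ε v, v.2)) := by
  rw [JordanChains.coneMap, D.weight_apply]

/-- The factor `ε ^ (k - i)` lifts the leading term `ε ^ i • S i` to order exactly `k` for every
`i`, and the part in `N` is already `O(ε ^ (k + 1))`. -/
lemma JordanChains.isBigO_weight (v : D.NcProd × D.N) :
    (fun ε => L ε (J.p ε (D.weight ε v)) - ε ^ k • J.sumS v.1)
      =O[𝓝[≠] 0] fun ε : 𝕜 => ε ^ (k + 1) := by
  have h1 : ∀ i : Fin (k + 1), (fun ε => ε ^ (k - (i : ℕ)) •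
      (L ε (J.p ε (v.1 i)) - ε ^ (i : ℕ) • (J.S i (v.1 i) : F)))
        =O[𝓝[≠] 0] fun ε : 𝕜 => ε ^ (k + 1) := by
    intro i
    have := smul_isBigO (d := k - (i : ℕ)) ((J.lead i (v.1 i)).mono
      (nhdsWithin_le_nhds (s := {0}ᶜ)))
    rwa [show (i : ℕ) + 1 + (k - i) = k + 1 by omega] at this
  have h2 := (J.kernel v.2).mono (nhdsWithin_le_nhds (s := {0}ᶜ))
  refine ((IsBigO.sum fun i (_ : i ∈ Finset.univ) => h1 i).add h2).congr_left fun ε => ?_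
  rw [D.weight_apply, J.sumS_apply, Finset.sum_apply]
  have hpow : ∀ i : Fin (k + 1), k - (i : ℕ) + i = k := fun i => by omega
  simp only [map_add, map_sum, map_smul, smul_sub, Finset.sum_sub_distrib, smul_smul, ← pow_add,
    Finset.smul_sum, hpow]
  simp only [JordanChains.p]
  abel

lemma JordanChains.exists_weight_quotient [CompleteSpace F] {r : ℝ} (hr : 0 < r) {s : ℕ∞}
    (hL : ContDiffOn 𝕜 (s + k) L (Metric.ball 0 r)) :
    ∃ A : 𝕜 → (D.NcProd × D.N) →L[𝕜] F, ContDiffOn 𝕜 s A (Metric.ball 0 r) ∧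
      (∀ ε ∈ Metric.ball (0 : 𝕜) r, ∀ v, L ε (J.p ε (D.weight ε v)) = ε ^ k • A ε v) ∧
      ∀ v, A 0 v = J.sumS v.1 := by
  have hball : Metric.ball (0 : 𝕜) r ∈ 𝓝 0 := Metric.ball_mem_nhds 0 hr
  obtain ⟨A, hA, hfA⟩ := exists_pow_quotient hr (n := s) k
    (f := fun ε => L ε ∘L J.p ε ∘L D.weight ε)
    (hL.clm_comp (J.contDiff_p.contDiffOn.clm_comp D.contDiff_weight.contDiffOn)) fun v => by
      have h0 : (fun ε : 𝕜 => ε) =O[𝓝 0] fun _ => (1 : 𝕜) :=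
        (continuousAt_id (x := (0 : 𝕜))).norm.isBoundedUnder_le.isBigO_one 𝕜
      have h1 : (fun ε : 𝕜 => ε ^ (k + 1)) =O[𝓝[≠] 0] fun ε : 𝕜 => ε ^ k := by
        simpa [pow_succ] using (isBigO_refl (fun ε : 𝕜 => ε ^ k) (𝓝[≠] 0)).mul
          (h0.mono nhdsWithin_le_nhds)
      have h2 : (fun ε : 𝕜 => ε ^ k • J.sumS v.1) =O[𝓝[≠] 0] fun ε : 𝕜 => ε ^ k := by
        have := (isBigO_refl (fun ε : 𝕜 => ε ^ k) (𝓝[≠] 0)).smul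
          (isBigO_const_const (J.sumS v.1) (one_ne_zero (α := 𝕜)) (𝓝[≠] 0))
        simpa using this
      simpa using ((J.isBigO_weight v).trans h1).add h2
  have hfA' : ∀ ε ∈ Metric.ball (0 : 𝕜) r, ∀ v, L ε (J.p ε (D.weight ε v)) = ε ^ k • A ε v := by
    intro ε hε v
    exact congrArg (fun T => T v) (hfA ε hε)
  refine ⟨A, hA, hfA', fun v => ?_⟩
  rw [← sub_eq_zero]
  refine eq_zero_of_isBigO_pow_succ (f := fun ε => A ε v - J.sumS v.1) (m := 0) ?_ ?_
  · exact ((hA.continuousOn.continuousAt hball).clm_apply continuousAt_const).sub continuousAt_const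
  · refine isBigO_of_smul_isBigO (d := k) ?_
    rw [zero_add, add_comm 1 k]
    refine (J.isBigO_weight v).congr' ?_ .rfl
    filter_upwards [nhdsWithin_le_nhds hball] with ε hε
    rw [hfA' ε hε, smul_sub]

end Weight

/-! ### The second order remainder and its uniform Lipschitz bound. -/

section Remainder

variable {𝕜 : Type*} [RCLike 𝕜]
  {B : Type*} [NormedAddCommGroup B] [NormedSpace 𝕜 B]
  {F : Type*} [NormedAddCommGroup F] [NormedSpace 𝕜 F]

/-- The remainder of second order of `G` along curves, divided by `ε ^ (2 * k)`. -/
lemma exists_remainder [CompleteSpace F] {s : ℕ∞} (k : ℕ) {G : B → F}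
    (hG : ContDiff 𝕜 (s + k + 1) G) :
    ∃ h : 𝕜 × B × B → F, ContDiff 𝕜 s h ∧ ∀ (ε : 𝕜) (x u : B),
      G (x + ε ^ k • u) = G x + ε ^ k • fderiv 𝕜 G x u + ε ^ (2 * k) • h (ε, x, u) := by
  -- For `k = 0` there is no power to divide out and `G` is only `C^(s+1)`, so the remainder is
  -- taken directly at the cost of one derivative. For positive `k` two Hadamard divisions in `τ = ε
  -- ^ k` are affordable.
  cases k with
  | zero =>
    have hG' : ContDiff 𝕜 (s + 1) G := by simpa using hG
    have h1 : ContDiff 𝕜 s G := hG'.of_le (by exact_mod_cast le_self_add)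
    have h2 : ContDiff 𝕜 s (fderiv 𝕜 G) := hG'.fderiv_right le_rfl
    refine ⟨fun q => G (q.2.1 + q.2.2) - G q.2.1 - fderiv 𝕜 G q.2.1 q.2.2, ?_, fun ε x u => ?_⟩
    · exact ((h1.comp (by fun_prop)).sub (h1.comp (by fun_prop))).sub
        ((h2.comp (by fun_prop)).clm_apply (by fun_prop))
    · simp
  | succ k =>
    obtain ⟨Q, hQ, h⟩ := exists_quadratic_remainder (n := s + k) (G := G)
      (by simpa [add_assoc] using hG)
    have hQ' : ContDiff 𝕜 s Q := hQ.of_le (by exact_mod_cast le_self_add)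
    refine ⟨fun q => Q (q.1 ^ (k + 1), q.2), hQ'.comp (by fun_prop), fun ε x u => ?_⟩
    rw [h, ← pow_mul, mul_comm 2]

lemma remainder_zero {k : ℕ} {G : B → F} {h : 𝕜 × B × B → F} (hc : Continuous h)
    (hh : ∀ (ε : 𝕜) (x u : B),
      G (x + ε ^ k • u) = G x + ε ^ k • fderiv 𝕜 G x u + ε ^ (2 * k) • h (ε, x, u))
    (ε : 𝕜) (x : B) : h (ε, x, 0) = 0 := by
  have h1 : (fun ε : 𝕜 => h (ε, x, 0)) = fun _ => 0 := by
    refine Continuous.ext_on (dense_compl_singleton (0 : 𝕜)) (hc.comp (by fun_prop))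
      continuous_const fun ε hε => ?_
    have := hh ε x 0
    simpa [pow_ne_zero _ (show ε ≠ 0 from hε)] using this
  exact congrFun h1 ε

/-- The remainder has a small Lipschitz constant near the origin. -/
lemma norm_remainder_sub_le {k : ℕ} {G : B → F} (hG : ContDiff 𝕜 2 G) {M : ℝ} (hM : 0 < M)
    (hG2 : ∀ x : B, ‖x‖ ≤ 1 / M → ‖fderiv 𝕜 (fderiv 𝕜 G) x‖ ≤ M)
    {h : 𝕜 × B × B → F} (hc : Continuous h)
    (hh : ∀ (ε : 𝕜) (x u : B),
      G (x + ε ^ k • u) = G x + ε ^ k • fderiv 𝕜 G x u + ε ^ (2 * k) • h (ε, x, u))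
    {ε : 𝕜} (hε : ‖ε‖ ≤ 1) {x : B} (hx : ‖x‖ ≤ 1 / (2 * M)) {ρ : ℝ} (hρ : ρ ≤ 1 / (2 * M))
    {u₁ u₂ : B} (hu₁ : ‖u₁‖ ≤ ρ) (hu₂ : ‖u₂‖ ≤ ρ) :
    ‖h (ε, x, u₁) - h (ε, x, u₂)‖ ≤ M * ρ * ‖u₁ - u₂‖ := by
  let _ : NormedSpace ℝ B := NormedSpace.restrictScalars ℝ 𝕜 B
  have hρ0 : 0 ≤ ρ := (norm_nonneg _).trans hu₁
  have hxM : ‖x‖ ≤ 1 / M := hx.trans (one_div_le_one_div_of_le hM (by linarith))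
  have hd1 : Differentiable 𝕜 G := hG.differentiable (by norm_num)
  have hd2 : Differentiable 𝕜 (fderiv 𝕜 G) :=
    (hG.fderiv_right (m := 1) (by norm_num)).differentiable (by norm_num)
  have hlip : ∀ y : B, ‖y‖ ≤ 1 / M → ‖fderiv 𝕜 G y - fderiv 𝕜 G x‖ ≤ M * ‖y - x‖ := by
    intro y hy
    refine (convex_closedBall (0 : B) (1 / M)).norm_image_sub_le_of_norm_fderiv_le
      (𝕜 := 𝕜) (fun y _ => hd2 y) (fun y hy => hG2 y (by simpa using hy)) (by simpa using hxM)
      (by simpa using hy)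
  -- The mean value inequality for `G - G'(x)` on the ball of radius `‖ε ^ k‖ * ρ` around `x`
  -- produces a factor `‖ε ^ k‖` twice, once from the variation of `G'` and once from the increment.
  -- Both cancel, so the bound involves no data except `M`; continuity extends it to `ε = 0`.
  have key : ∀ ε : 𝕜, ε ≠ 0 → ‖ε‖ ≤ 1 →
      ‖h (ε, x, u₁) - h (ε, x, u₂)‖ ≤ M * ρ * ‖u₁ - u₂‖ := by
    intro ε hε0 hε
    have hpow : ‖ε ^ k‖ ≤ 1 := by
      rw [norm_pow]
      exact pow_le_one₀ (norm_nonneg _) hε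
    have hmem : ∀ u : B, ‖u‖ ≤ ρ → x + ε ^ k • u ∈ Metric.closedBall x (‖ε ^ k‖ * ρ) := by
      intro u hu
      rw [mem_closedBall_iff_norm, add_sub_cancel_left, norm_smul]
      exact mul_le_mul_of_nonneg_left hu (norm_nonneg _)
    have h1 := (convex_closedBall x (‖ε ^ k‖ * ρ)).norm_image_sub_le_of_norm_fderiv_le'
      (𝕜 := 𝕜) (f := G) (φ := fderiv 𝕜 G x) (C := M * (‖ε ^ k‖ * ρ)) (fun y _ => hd1 y)
      (fun y hy => by
        rw [mem_closedBall_iff_norm] at hy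
        refine (hlip y ?_).trans (mul_le_mul_of_nonneg_left hy hM.le)
        have h2 : ‖ε ^ k‖ * ρ ≤ ρ := mul_le_of_le_one_left hρ0 hpow
        have h3 : ‖y‖ ≤ ‖y - x‖ + ‖x‖ := by simpa using norm_add_le (y - x) x
        have h4 : 1 / M = 1 / (2 * M) + 1 / (2 * M) := by field_simp; norm_num
        linarith) (hmem u₂ hu₂) (hmem u₁ hu₁)
    have h2 : G (x + ε ^ k • u₁) - G (x + ε ^ k • u₂) -
        fderiv 𝕜 G x (x + ε ^ k • u₁ - (x + ε ^ k • u₂)) =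
        (ε ^ k * ε ^ k) • (h (ε, x, u₁) - h (ε, x, u₂)) := by
      rw [hh, hh, add_sub_add_left_eq_sub, ← smul_sub, map_smul, map_sub, ← pow_add, ← two_mul]
      module
    rw [h2, add_sub_add_left_eq_sub, ← smul_sub, norm_smul, norm_smul, norm_mul] at h1
    have hpos : 0 < ‖ε ^ k‖ * ‖ε ^ k‖ := by
      have := norm_pos_iff.2 (pow_ne_zero k hε0)
      positivity
    refine le_of_mul_le_mul_left ?_ hpos
    calc _ ≤ _ := h1
      _ = _ := by ring
  by_cases hε0 : ε = 0
  · subst hε0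
    have hcu : ∀ u, Tendsto (fun ε : 𝕜 => h (ε, x, u)) (𝓝[≠] 0) (𝓝 (h (0, x, u))) := fun u =>
      ((hc.comp (by fun_prop : Continuous fun ε : 𝕜 => (ε, x, u))).tendsto 0).mono_left
        nhdsWithin_le_nhds
    refine le_of_tendsto ((hcu u₁).sub (hcu u₂)).norm ?_
    filter_upwards [self_mem_nhdsWithin,
      nhdsWithin_le_nhds (Metric.closedBall_mem_nhds (0 : 𝕜) one_pos)] with ε h1 h2
    exact key ε h1 (by simpa using h2)
  · exact key ε hε0 hε

end Remainder

/-! ### The reduced equation near `ε = 0`. -/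

section Reduced

variable {𝕜 : Type*} [RCLike 𝕜]
  {B : Type*} [NormedAddCommGroup B] [NormedSpace 𝕜 B]
  {F : Type*} [NormedAddCommGroup F] [NormedSpace 𝕜 F]
  {X N : Type*} [NormedAddCommGroup X] [NormedSpace 𝕜 X] [NormedAddCommGroup N] [NormedSpace 𝕜 N]

/-- The increment of `G` along `z(ε) + ε ^ k p(ε) w(ε) v`, divided by `ε ^ (2 * k)` and mapped to
the parameter space: the linear part `A` plus the remainder `h`. -/
def reducedMap (h : 𝕜 × B × B → F) (z : 𝕜 → B) (p : 𝕜 → B →L[𝕜] B) (w : 𝕜 → X × N →L[𝕜] B)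
    (A : 𝕜 → X × N →L[𝕜] F) (T : F →L[𝕜] X) (ε : 𝕜) (v : X × N) : X :=
  T (A ε v + h (ε, z ε, p ε (w ε v)))

variable {h : 𝕜 × B × B → F} {z : 𝕜 → B} {p : 𝕜 → B →L[𝕜] B} {w : 𝕜 → X × N →L[𝕜] B}
  {A : 𝕜 → X × N →L[𝕜] F} {T : F →L[𝕜] X}

lemma contDiffOn_reducedMap {n : WithTop ℕ∞} {O : Set 𝕜} (hh : ContDiff 𝕜 n h)
    (hz : ContDiffOn 𝕜 n z O) (hp : ContDiff 𝕜 n p) (hw : ContDiff 𝕜 n w)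
    (hA : ContDiffOn 𝕜 n A O) :
    ContDiffOn 𝕜 n (Function.uncurry (reducedMap h z p w A T)) (O ×ˢ univ) := by
  have hfst : ContDiffOn 𝕜 n (fun q : 𝕜 × X × N => q.1) (O ×ˢ univ) := contDiff_fst.contDiffOn
  have hsnd : ContDiffOn 𝕜 n (fun q : 𝕜 × X × N => q.2) (O ×ˢ univ) := contDiff_snd.contDiffOn
  have hmaps : MapsTo (fun q : 𝕜 × X × N => q.1) (O ×ˢ univ) O := fun q hq => hq.1
  have h1 : ContDiffOn 𝕜 n (fun q : 𝕜 × X × N => A q.1 q.2) (O ×ˢ univ) :=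
    (hA.comp hfst hmaps).clm_apply hsnd
  have h2 : ContDiffOn 𝕜 n (fun q : 𝕜 × X × N => p q.1 (w q.1 q.2)) (O ×ˢ univ) :=
    (hp.comp_contDiffOn hfst).clm_apply ((hw.comp_contDiffOn hfst).clm_apply hsnd)
  have h3 : ContDiffOn 𝕜 n (fun q : 𝕜 × X × N => h (q.1, z q.1, p q.1 (w q.1 q.2)))
      (O ×ˢ univ) := hh.comp_contDiffOn (hfst.prodMk ((hz.comp hfst hmaps).prodMk h2))
  exact T.contDiff.comp_contDiffOn (h1.add h3)

lemma contDiff_reducedMap {n : WithTop ℕ∞} (hh : ContDiff 𝕜 n h) (ε : 𝕜) :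
    ContDiff 𝕜 n (reducedMap h z p w A T ε) := by
  unfold reducedMap
  have : ContDiff 𝕜 n (fun v : X × N => h (ε, z ε, p ε (w ε v))) := hh.comp (by fun_prop)
  fun_prop

/-- The constant `1/4` is `1/8 + 1/8`: one half from `‖T‖ * ‖A ε - A 0‖` for small `ε`, the other
from the remainder, `M * M * (2cR) * (2c) = 32 c² M² R / 8`. Only `O` depends on the data. The
condition `4cR ≤ 1 / M` keeps the arguments where the second derivative is bounded. -/
lemma exists_nhds_reducedMap [CompleteSpace B] {O₀ : Set 𝕜} (hO₀ : O₀ ∈ 𝓝 0) {k : ℕ} {G : B → F}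
    (hG : ContDiff 𝕜 2 G) {M : ℝ} (hM : 0 < M)
    (hG2 : ∀ x : B, ‖x‖ ≤ 1 / M → ‖fderiv 𝕜 (fderiv 𝕜 G) x‖ ≤ M)
    (hc : Continuous h)
    (hh : ∀ (ε : 𝕜) (x u : B),
      G (x + ε ^ k • u) = G x + ε ^ k • fderiv 𝕜 G x u + ε ^ (2 * k) • h (ε, x, u))
    (hz : ContinuousAt z 0) (hz0 : z 0 = 0) (hp : ContinuousAt p 0)
    (hp0 : p 0 = ContinuousLinearMap.id 𝕜 B) {c : ℝ} (hc1 : 0 ≤ c)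
    (hw : ∀ ε : 𝕜, ‖ε‖ ≤ 1 → ∀ v, ‖w ε v‖ ≤ c * ‖v‖) (hA : ContinuousAt A 0)
    (hA0 : ∀ v, T (A 0 v) = v.1) (hT : ‖T‖ ≤ M) {R : ℝ} (hR1 : 4 * c * R ≤ 1 / M)
    (hR2 : 32 * c ^ 2 * M ^ 2 * R ≤ 1) :
    ∃ O : Set 𝕜, IsOpen O ∧ (0 : 𝕜) ∈ O ∧ O ⊆ O₀ ∧ (∀ ε ∈ O, IsUnit (p ε)) ∧
      (∀ ε ∈ O, reducedMap h z p w A T ε 0 = 0) ∧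
      ∀ ε ∈ O, ∀ v₁ ∈ Metric.ball (0 : X × N) R, ∀ v₂ ∈ Metric.ball (0 : X × N) R,
      ‖(reducedMap h z p w A T ε v₁ - v₁.1) - (reducedMap h z p w A T ε v₂ - v₂.1)‖ ≤
        1 / 4 * ‖v₁ - v₂‖ := by
  have e1 : ∀ᶠ ε in 𝓝 (0 : 𝕜), ‖ε‖ ≤ 1 := by
    filter_upwards [Metric.closedBall_mem_nhds (0 : 𝕜) one_pos] with ε hε
    simpa using hε
  have e2 : ∀ᶠ ε in 𝓝 (0 : 𝕜), ‖z ε‖ ≤ 1 / (2 * M) := by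
    have : ‖z 0‖ < 1 / (2 * M) := by
      rw [hz0, norm_zero]
      positivity
    exact (hz.norm.eventually (gt_mem_nhds this)).mono fun _ h => h.le
  have e3 : ∀ᶠ ε in 𝓝 (0 : 𝕜), ‖p ε‖ ≤ 2 := by
    have : ‖p 0‖ < 2 := by
      rw [hp0]
      exact ContinuousLinearMap.norm_id_le.trans_lt one_lt_two
    exact (hp.norm.eventually (gt_mem_nhds this)).mono fun _ h => h.le
  have e4 : ∀ᶠ ε in 𝓝 (0 : 𝕜), IsUnit (p ε) := by
    refine hp.eventually (Units.isOpen.mem_nhds ?_)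
    rw [hp0]
    exact isUnit_one
  have e5 : ∀ᶠ ε in 𝓝 (0 : 𝕜), ‖A ε - A 0‖ ≤ 1 / (8 * M) := by
    have : ‖A 0 - A 0‖ < 1 / (8 * M) := by
      rw [sub_self, norm_zero]
      positivity
    exact ((hA.sub continuousAt_const).norm.eventually (gt_mem_nhds this)).mono fun _ h => h.le
  obtain ⟨O, hO, hOo, h0O⟩ := eventually_nhds_iff.1
    ((((e1.and e2).and (e3.and e4)).and e5).and hO₀)
  refine ⟨O, hOo, h0O, fun ε hε => (hO ε hε).2, fun ε hε => (hO ε hε).1.1.2.2, fun ε hε => ?_,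
    fun ε hε v₁ hv₁ v₂ hv₂ => ?_⟩
  · simp [reducedMap, remainder_zero hc hh]
  · obtain ⟨⟨⟨⟨h1, h2⟩, h3, -⟩, h5⟩, -⟩ := hO ε hε
    rw [mem_ball_zero_iff] at hv₁ hv₂
    have hR : 0 < R := (norm_nonneg _).trans_lt hv₁
    have hu : ∀ v : X × N, ‖p ε (w ε v)‖ ≤ 2 * c * ‖v‖ := by
      intro v
      refine ((p ε).le_opNorm _).trans ?_
      have := mul_le_mul h3 (hw ε h1 v) (norm_nonneg _) zero_le_two
      linarith
    have hu' : ∀ v : X × N, ‖v‖ < R → ‖p ε (w ε v)‖ ≤ 2 * c * R := fun v hv =>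
      (hu v).trans (mul_le_mul_of_nonneg_left hv.le (by positivity))
    have hRM : 2 * c * R ≤ 1 / (2 * M) := by
      have : 1 / (2 * M) = 1 / M / 2 := by field_simp
      rw [this]
      linarith
    have hrem := norm_remainder_sub_le hG hM hG2 hc hh h1 h2 hRM (hu' v₁ hv₁) (hu' v₂ hv₂)
    rw [← map_sub, ← map_sub] at hrem
    have hrem' : ‖h (ε, z ε, p ε (w ε v₁)) - h (ε, z ε, p ε (w ε v₂))‖ ≤
        M * (2 * c * R) * (2 * c * ‖v₁ - v₂‖) :=
      hrem.trans (mul_le_mul_of_nonneg_left (hu _) (by positivity))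
    have hlin : ‖(A ε - A 0) (v₁ - v₂)‖ ≤ 1 / (8 * M) * ‖v₁ - v₂‖ :=
      ((A ε - A 0).le_opNorm _).trans (mul_le_mul_of_nonneg_right h5 (norm_nonneg _))
    have heq : (reducedMap h z p w A T ε v₁ - v₁.1) - (reducedMap h z p w A T ε v₂ - v₂.1) =
        T ((A ε - A 0) (v₁ - v₂) +
          (h (ε, z ε, p ε (w ε v₁)) - h (ε, z ε, p ε (w ε v₂)))) := by
      rw [← hA0 v₁, ← hA0 v₂]
      simp only [reducedMap, map_add, map_sub, _root_.sub_apply]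
      abel
    rw [heq]
    calc _ ≤ ‖T‖ * _ := T.le_opNorm _
      _ ≤ M * (1 / (8 * M) * ‖v₁ - v₂‖ + M * (2 * c * R) * (2 * c * ‖v₁ - v₂‖)) :=
        mul_le_mul hT ((norm_add_le _ _).trans (add_le_add hlin hrem')) (norm_nonneg _) hM.le
      _ = (1 / 8 + 32 * c ^ 2 * M ^ 2 * R / 8) * ‖v₁ - v₂‖ := by
        field_simp
        ring
      _ ≤ 1 / 4 * ‖v₁ - v₂‖ := by
        refine mul_le_mul_of_nonneg_right ?_ (norm_nonneg _)
        linarith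

end Reduced

/-! ### Near identity and diffeomorphism from the solution. -/

section Linearizing

variable {𝕜 : Type*} [RCLike 𝕜]
  {B : Type*} [NormedAddCommGroup B] [NormedSpace 𝕜 B]
  {F : Type*} [NormedAddCommGroup F] [NormedSpace 𝕜 F]
  {L : 𝕜 → B →L[𝕜] F} {k : ℕ} {D : Decomposition L k} (J : JordanChains D)

/-- A solution `ψ` of a reduced equation whose left hand side at `ε = 0` is the identity plus a
quadratic perturbation depending only on the last component of `ψ` and on `n` is a near identity. -/
lemma near_id_of_solution {R C : ℝ} {f : D.NcProd × D.N → D.NcProd} {η : B → D.NcProd}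
    (hf : ∀ v, f v = v.1 + η ((v.1 (Fin.last k) : B) + (v.2 : B)))
    (hη : ∀ v : D.NcProd × D.N, ‖v‖ < R →
      ‖η ((v.1 (Fin.last k) : B) + (v.2 : B))‖ ≤ C * ‖v‖ ^ 2) (hC : 0 ≤ C)
    {ψ₀ : D.NcProd × D.N → D.NcProd}
    (hψ : ∀ v ∈ Metric.ball (0 : D.NcProd × D.N) (R / 4),
      ‖ψ₀ v‖ ≤ 2 * ‖v‖ ∧ f (ψ₀ v, v.2) = v.1 ∧ ∀ x, ‖x‖ < R → f (x, v.2) = v.1 → x = ψ₀ v) :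
    ∃ (χ : D.Nc (Fin.last k) × D.N → D.NcProd) (C : ℝ),
      ∀ v ∈ Metric.ball (0 : D.NcProd × D.N) (R / 4),
        ψ₀ v = v.1 + χ (v.1 (Fin.last k), v.2) ∧
        ‖χ (v.1 (Fin.last k), v.2)‖ ≤ C * ‖(v.1 (Fin.last k), v.2)‖ ^ 2 := by
  -- `χ` is the correction found when all components but the last are zero; the remaining ones enter
  -- the equation only additively.
  let ι : D.Nc (Fin.last k) × D.N → D.NcProd × D.N := fun a => (Pi.single (Fin.last k) a.1, a.2)
  have hι : ∀ a, ‖ι a‖ = ‖a‖ := by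
    intro a
    simp only [ι, Prod.norm_def]
    rw [Pi.norm_single]
  refine ⟨fun a => ψ₀ (ι a) - Pi.single (Fin.last k) a.1, C * 4, fun v hv => ?_⟩
  set a : D.Nc (Fin.last k) × D.N := (v.1 (Fin.last k), v.2) with ha
  have hav : ‖a‖ ≤ ‖v‖ := by
    rw [ha, Prod.norm_def, Prod.norm_def]
    exact max_le_max (norm_le_pi_norm v.1 _) le_rfl
  rw [mem_ball_zero_iff] at hv
  have hιv : ι a ∈ Metric.ball (0 : D.NcProd × D.N) (R / 4) := by
    rw [mem_ball_zero_iff, hι]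
    exact hav.trans_lt hv
  obtain ⟨h1, h2, -⟩ := hψ (ι a) hιv
  rw [hι] at h1
  set x := ψ₀ (ι a) with hx
  have hfx := hf (x, (ι a).2)
  rw [h2] at hfx
  set e : D.NcProd := Pi.single (Fin.last k) a.1 with he
  have hlast : e (Fin.last k) = v.1 (Fin.last k) := Pi.single_eq_same _ _
  have hsingle : ‖e‖ ≤ ‖a‖ := by
    rw [Pi.norm_single]
    exact norm_fst_le a
  have hχ : x - e = -η ((x (Fin.last k) : B) + (v.2 : B)) := by
    have h3 : e =
      x + η ((x (Fin.last k) : B) + (v.2 : B)) := hfx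
    rw [h3]
    abel
  constructor
  -- The candidate `v.1 + (x - e)` has the last component of `x`, so it solves the equation. Its
  -- norm is at most `‖v‖ + 2‖v‖ + ‖v‖ < R`, which the radius `R / 4` allows for uniqueness.
  · refine ((hψ v (by simpa using hv)).2.2 _ ?_ ?_).symm
    · refine (norm_add_le _ _).trans_lt ?_
      have h4 := norm_sub_le x (e)
      have h5 := norm_fst_le v
      linarith
    · rw [hf]
      have h3 : (v.1 + (x - e) : D.NcProd) (Fin.last k) = x (Fin.last k) := by
        rw [Pi.add_apply, Pi.sub_apply, hlast, add_sub_cancel]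
      show v.1 + (x - e) + η (((v.1 + (x - e) : D.NcProd) (Fin.last k) : B) + (v.2 : B)) = v.1
      rw [h3, hχ, add_assoc, neg_add_cancel, add_zero]
  · show ‖x - e‖ ≤ _
    rw [hχ, norm_neg]
    have hxv : ‖((x, v.2) : D.NcProd × D.N)‖ ≤ 2 * ‖a‖ := by
      rw [Prod.norm_def]
      refine max_le h1 ?_
      have : ‖v.2‖ ≤ ‖a‖ := norm_snd_le a
      linarith [norm_nonneg a]
    refine (hη (x, v.2) ?_).trans ?_
    · linarith [norm_nonneg v]
    · have : ‖((x, v.2) : D.NcProd × D.N)‖ ^ 2 ≤ (2 * ‖a‖) ^ 2 :=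
        pow_le_pow_left₀ (norm_nonneg _) hxv 2
      calc _ ≤ C * (2 * ‖a‖) ^ 2 := mul_le_mul_of_nonneg_left this hC
        _ = _ := by ring

/-- For `ε ≠ 0` the solution of the reduced equation induces a diffeomorphism onto an open set. -/
lemma diffeo_of_solution [CompleteSpace B] (hL : ContinuousAt L 0) {n : WithTop ℕ∞} {R : ℝ}
    {z : 𝕜 → B} {ψ : 𝕜 → D.NcProd × D.N → D.NcProd} {ε : 𝕜} (hε : ε ≠ 0) (hp : IsUnit (J.p ε))
    {f : D.NcProd × D.N → D.NcProd} (hf : ContDiff 𝕜 n f)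
    (hψ : ∀ v ∈ Metric.ball (0 : D.NcProd × D.N) (R / 4),
      ‖ψ ε v‖ ≤ 2 * ‖v‖ ∧ f (ψ ε v, v.2) = v.1 ∧ ∀ x, ‖x‖ < R → f (x, v.2) = v.1 → x = ψ ε v) :
    IsOpen (J.coneMap z ψ ε '' Metric.ball 0 (R / 4)) ∧
      ∃ g : B → D.NcProd × D.N,
        ContDiffOn 𝕜 n g (J.coneMap z ψ ε '' Metric.ball 0 (R / 4)) ∧
        ∀ v ∈ Metric.ball (0 : D.NcProd × D.N) (R / 4), g (J.coneMap z ψ ε v) = v := by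
  obtain ⟨W, hW⟩ := D.exists_equiv_weight hL hε
  obtain ⟨u, hu⟩ := hp
  let P : B ≃L[𝕜] B := ContinuousLinearEquiv.unitsEquiv 𝕜 B u
  have hP : ∀ x, P x = J.p ε x := fun x => by rw [← hu]; rfl
  -- `a` recovers `(ψ, n)` from a point of the cone; applying `f` then returns `φ`. The resulting
  -- inverse is globally defined and smooth.
  let a : B → D.NcProd × D.N := fun x => W.symm (P.symm ((ε ^ k)⁻¹ • (x - z ε)))
  have ha : ContDiff 𝕜 n a :=
    W.symm.contDiff.comp (P.symm.contDiff.comp ((contDiff_id.sub contDiff_const).const_smul _))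
  have hacone : ∀ v, a (J.coneMap z ψ ε v) = (ψ ε v, v.2) := by
    intro v
    simp only [a]
    rw [J.coneMap_eq, add_sub_cancel_left, smul_smul, inv_mul_cancel₀ (pow_ne_zero k hε), one_smul,
      ← hW, ← hP, P.symm_apply_apply, W.symm_apply_apply]
  have hainv : ∀ x, z ε + ε ^ k • J.p ε (D.weight ε (a x)) = x := by
    intro x
    simp only [a]
    rw [← hW, W.apply_symm_apply, ← hP, P.apply_symm_apply, smul_smul,
      mul_inv_cancel₀ (pow_ne_zero k hε), one_smul, add_sub_cancel]
  let g : B → D.NcProd × D.N := fun x => (f (a x), (a x).2)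
  have hg : ContDiff 𝕜 n g := (hf.comp ha).prodMk (contDiff_snd.comp ha)
  have hgcone : ∀ v ∈ Metric.ball (0 : D.NcProd × D.N) (R / 4), g (J.coneMap z ψ ε v) = v := by
    intro v hv
    simp only [g, hacone]
    rw [(hψ v hv).2.1]
  -- By uniqueness of the solution in the ball of radius `R`, the image is cut out by open
  -- conditions.
  have himage : J.coneMap z ψ ε '' Metric.ball 0 (R / 4) =
      (fun x => (a x).1) ⁻¹' Metric.ball 0 R ∩ g ⁻¹' Metric.ball 0 (R / 4) := by
    ext x
    constructor
    · rintro ⟨v, hv, rfl⟩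
      refine ⟨?_, ?_⟩
      · rw [mem_preimage, hacone, mem_ball_zero_iff]
        have h1 := (hψ v hv).1
        rw [mem_ball_zero_iff] at hv
        simp only
        linarith [norm_nonneg v]
      · rw [mem_preimage, hgcone v hv]
        exact hv
    · rintro ⟨h1, h2⟩
      refine ⟨g x, h2, ?_⟩
      have h3 : (a x).1 = ψ ε (g x) := (hψ (g x) h2).2.2 _ (by simpa using h1) rfl
      rw [J.coneMap_eq, ← h3]
      exact hainv x
  refine ⟨?_, g, hg.contDiffOn, hgcone⟩
  rw [himage]
  exact (Metric.isOpen_ball.preimage (continuous_fst.comp ha.continuous)).inter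
    (Metric.isOpen_ball.preimage hg.continuous)

end Linearizing

/-! ### The linearizing transformation and the zeros in the cone. -/

section Main

variable {𝕜 : Type*} [RCLike 𝕜]
  {B : Type*} [NormedAddCommGroup B] [NormedSpace 𝕜 B]
  {F : Type*} [NormedAddCommGroup F] [NormedSpace 𝕜 F]
  {k : ℕ} {s : ℕ∞} {U : Set 𝕜} {z : 𝕜 → B} {G : B → F}

lemma IsSetting.contDiffOn_linearization (h : IsSetting (s + k + 1) k U z G) :
    ContDiffOn 𝕜 (s + k) (linearization G z) U := by
  have h1 : ContDiff 𝕜 ((s + k : ℕ∞) + 1) G := by simpa using h.G_smooth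
  have h2 : ContDiff 𝕜 (s + k) (fderiv 𝕜 G) := h1.fderiv_right le_rfl
  exact h2.comp_contDiffOn (h.z_smooth.of_le (by exact_mod_cast le_self_add))

lemma IsSetting.contDiffAt_linearization (hs : 1 ≤ s) (h : IsSetting (s + k + 1) k U z G) :
    ContDiffAt 𝕜 (k + 1 : ℕ) (linearization G z) 0 := by
  refine (h.contDiffOn_linearization.contDiffAt (h.isOpen.mem_nhds h.zero_mem)).of_le ?_
  have : ((k + 1 : ℕ) : ℕ∞) ≤ s + k := by
    rw [Nat.cast_succ, add_comm]
    gcongr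
  exact_mod_cast this

variable {D : Decomposition (linearization G z) k} {J : JordanChains D}

/-- The linearizing transformation, on a ball whose radius depends only on `M` and `k`. -/
lemma exists_isLinearizing [CompleteSpace B] [CompleteSpace F] (hs : 1 ≤ s)
    (h : IsSetting (s + k + 1) k U z G) {M : ℝ} (hM : 0 < M) (hJ : ‖J.sumS.inverse‖ ≤ M)
    (hG2 : ∀ x : B, ‖x‖ ≤ 1 / M → ‖fderiv 𝕜 (fderiv 𝕜 G) x‖ ≤ M) {R : ℝ} (hR : 0 < R)
    (hR1 : 4 * (k + 2) * R ≤ 1 / M) (hR2 : 32 * (k + 2) ^ 2 * M ^ 2 * R ≤ 1) :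
    ∃ (U₀ : Set 𝕜) (ψ : 𝕜 → D.NcProd × D.N → D.NcProd),
      IsOpen U₀ ∧ (0 : 𝕜) ∈ U₀ ∧ U₀ ⊆ U ∧
      J.IsLinearizing G z s U₀ (Metric.ball 0 (R / 4)) ψ := by
  have := fun i => (D.isClosed_Nc i).completeSpace_coe
  have : CompleteSpace D.N := D.isClosed_N.completeSpace_coe
  have hU : U ∈ 𝓝 0 := h.isOpen.mem_nhds h.zero_mem
  have hLc : ContinuousAt (linearization G z) 0 := (h.contDiffAt_linearization hs).continuousAt
  have hS := J.sumS_isInvertible h.kSurjective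
  have hs0 : (s : WithTop ℕ∞) ≠ 0 := by
    have : s ≠ 0 := (zero_lt_one.trans_le hs).ne'
    exact_mod_cast this
  have hGs : ContDiff 𝕜 (s + k + 1) G := by simpa using h.G_smooth
  have hG : ContDiff 𝕜 2 G := by
    refine h.G_smooth.of_le ?_
    have : (2 : ℕ∞) ≤ s + k + 1 := by
      rw [← one_add_one_eq_two]
      gcongr
      exact hs.trans le_self_add
    exact WithTop.coe_le_coe.2 this
  obtain ⟨r, hr, hrU⟩ := Metric.mem_nhds_iff.1 hU
  have hball : Metric.ball (0 : 𝕜) r ∈ 𝓝 0 := Metric.ball_mem_nhds 0 hr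
  obtain ⟨A, hA, hLA, hA0⟩ := J.exists_weight_quotient hr (h.contDiffOn_linearization.mono hrU)
  obtain ⟨q, hq, hqG⟩ := exists_remainder k hGs
  have hzs : ContDiffOn 𝕜 s z U := h.z_smooth.of_le (by
    have : s ≤ s + k + 1 := by
      rw [add_assoc]
      exact le_self_add
    exact_mod_cast this)
  have hTA : ∀ v, J.sumS.inverse (A 0 v) = v.1 := fun v => by
    rw [hA0, hS.inverse_apply_self]
  obtain ⟨O, hO, h0O, hOr, hunit, he0, hlip⟩ := exists_nhds_reducedMap (w := D.weight)
    (T := J.sumS.inverse) hball hG hM hG2 hq.continuous hqG (hzs.continuousOn.continuousAt hU)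
    h.z_zero (J.contDiff_p (n := 0)).continuous.continuousAt J.p_zero (c := k + 2) (by positivity)
    (fun ε hε v => D.norm_weight_le hε v) (hA.continuousOn.continuousAt hball) hTA hJ
    hR1 hR2
  set e := reducedMap q z J.p D.weight A J.sumS.inverse with he
  have hOU : O ⊆ U := hOr.trans hrU
  have hes : ContDiffOn 𝕜 s (Function.uncurry e) (O ×ˢ univ) :=
    contDiffOn_reducedMap hq (hzs.mono hOU) J.contDiff_p D.contDiff_weight (hA.mono hOr)
  obtain ⟨ψ, hψ, hψs⟩ := exists_uniform_inverse hs0 hO hes he0 hlip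
  -- The linear part carries `ε ^ k` from the increment and `ε ^ k` from `A`, matching the factor `ε
  -- ^ (2 * k)` of the remainder.
  have hGe : ∀ ε ∈ O, ∀ v, G (z ε + ε ^ k • J.p ε (D.weight ε v)) =
      G (z ε) + ε ^ (2 * k) • J.sumS (e ε v) := by
    intro ε hε v
    have h1 : fderiv 𝕜 G (z ε) (J.p ε (D.weight ε v)) = ε ^ k • A ε v := hLA ε (hOr hε) v
    rw [hqG, h1, he, reducedMap, hS.self_apply_inverse, smul_smul, ← pow_add, ← two_mul, smul_add,
      add_assoc]
  refine ⟨O, ψ, hO, h0O, hOU, ⟨hψs, fun ε hε => ?_, ?_, fun ε hε v hv => ?_, fun ε hε hε0 => ?_⟩⟩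
  · have h1 := (hψ ε hε 0 (Metric.mem_ball_self (by positivity))).1
    rw [norm_zero, mul_zero] at h1
    exact norm_le_zero_iff.1 h1
  · refine near_id_of_solution (R := R) (C := M * M * (k + 2) ^ 2) (f := e 0)
      (η := fun u => J.sumS.inverse (q (0, 0, u))) (fun v => ?_) (fun v hv => ?_) (by positivity)
      (hψ 0 h0O)
    · rw [he, reducedMap, map_add, hTA, h.z_zero, J.p_zero, D.weight_zero]
      rfl
    · rw [← D.weight_zero]
      have h1 : ‖D.weight 0 v‖ ≤ (k + 2) * ‖v‖ := D.norm_weight_le (by simp) v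
      have h2 : ‖D.weight 0 v‖ ≤ 1 / (2 * M) := by
        have h3 : (k + 2 : ℝ) * ‖v‖ ≤ (k + 2) * R :=
          mul_le_mul_of_nonneg_left hv.le (by positivity)
        have h4 : 0 < (k + 2 : ℝ) * R := by positivity
        have h5 : 1 / (2 * M) = 1 / M / 2 := by field_simp
        rw [h5]
        linarith
      have h3 := norm_remainder_sub_le hG hM hG2 hq.continuous hqG (ε := 0) (x := 0) (by simp)
        (by rw [norm_zero]; positivity) h2 le_rfl
        (by rw [norm_zero]; positivity : ‖(0 : B)‖ ≤ ‖D.weight 0 v‖)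
      rw [remainder_zero hq.continuous hqG, sub_zero, sub_zero] at h3
      calc ‖J.sumS.inverse (q (0, 0, D.weight 0 v))‖
          ≤ ‖J.sumS.inverse‖ * ‖q (0, 0, D.weight 0 v)‖ := J.sumS.inverse.le_opNorm _
        _ ≤ M * (M * ‖D.weight 0 v‖ * ‖D.weight 0 v‖) :=
          mul_le_mul hJ h3 (norm_nonneg _) hM.le
        _ = M * M * ‖D.weight 0 v‖ ^ 2 := by ring
        _ ≤ M * M * ((k + 2) * ‖v‖) ^ 2 :=
          mul_le_mul_of_nonneg_left (pow_le_pow_left₀ (norm_nonneg _) h1 2) (by positivity)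
        _ = M * M * (k + 2) ^ 2 * ‖v‖ ^ 2 := by ring
  · rw [J.coneMap_eq, hGe ε hε, (hψ ε hε v hv).2.1]
  · exact diffeo_of_solution J hLc hε0 (hunit ε hε) (contDiff_reducedMap hq ε) (hψ ε hε)

variable {U₀ : Set 𝕜} {ψ : 𝕜 → D.NcProd × D.N → D.NcProd} {ρ : ℝ}

/-- The zeros in the cone when `G(z(ε))` is of order `ε ^ (2 * k)`. -/
lemma JordanChains.IsLinearizing.exists_zeros (hψ : J.IsLinearizing G z s U₀ (Metric.ball 0 ρ) ψ)
    (hS : J.sumS.IsInvertible) (hU₀ : IsOpen U₀) (h0 : (0 : 𝕜) ∈ U₀) {b : 𝕜 → F}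
    (hb : ContinuousAt b 0) (hGb : ∀ ε ∈ U₀, G (z ε) = ε ^ (2 * k) • b ε)
    (hb0 : ‖J.sumS.inverse (b 0)‖ < ρ) :
    ∃ U₁ : Set 𝕜, IsOpen U₁ ∧ (0 : 𝕜) ∈ U₁ ∧ U₁ ⊆ U₀ ∧
      ∃ φ₀ : 𝕜 → D.NcProd, (∀ ε, φ₀ ε = -J.sumS.inverse (b ε)) ∧
        (∀ ε ∈ U₁, ‖φ₀ ε‖ < ρ) ∧
        (∀ ε ∈ U₁, ∀ (φ : D.NcProd) (n : D.N), (φ + φ₀ ε, n) ∈ Metric.ball 0 ρ →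
          G (J.coneMap z ψ ε (φ + φ₀ ε, n)) = ε ^ (2 * k) • J.sumS φ) ∧
        {x | x ∈ J.cone z ψ U₁ (Metric.ball 0 ρ) ∧ G x = 0} =
          {x | ∃ ε ∈ U₁, ε ≠ 0 ∧ ∃ n : D.N, ‖n‖ < ρ ∧ x = J.coneMap z ψ ε (φ₀ ε, n)} := by
  have hev : ∀ᶠ ε in 𝓝 (0 : 𝕜), ‖J.sumS.inverse (b ε)‖ < ρ :=
    (J.sumS.inverse.continuous.continuousAt.comp hb).norm.eventually (gt_mem_nhds hb0)
  obtain ⟨U₁, hU₁, hU₁o, h0U₁⟩ := eventually_nhds_iff.1 (hev.and (hU₀.mem_nhds h0))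
  have hG : ∀ ε ∈ U₁, ∀ (φ : D.NcProd) (n : D.N),
      (φ + -J.sumS.inverse (b ε), n) ∈ Metric.ball 0 ρ →
      G (J.coneMap z ψ ε (φ + -J.sumS.inverse (b ε), n)) = ε ^ (2 * k) • J.sumS φ := by
    intro ε hε φ n hv
    rw [hψ.linear ε (hU₁ ε hε).2 _ hv, hGb ε (hU₁ ε hε).2, ← smul_add, map_add, map_neg,
      hS.self_apply_inverse]
    congr 1
    abel
  refine ⟨U₁, hU₁o, h0U₁, fun ε hε => (hU₁ ε hε).2, fun ε => -J.sumS.inverse (b ε), fun _ => rfl,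
    fun ε hε => by simpa using (hU₁ ε hε).1, hG, ?_⟩
  ext x
  constructor
  · rintro ⟨⟨ε, hε, hε0, v, hv, rfl⟩, hx⟩
    refine ⟨ε, hε, hε0, v.2, (norm_snd_le v).trans_lt (by simpa using hv), ?_⟩
    have h1 := hG ε hε (v.1 + J.sumS.inverse (b ε)) v.2 (by simpa using hv)
    rw [add_neg_cancel_right, hx] at h1
    -- Off `ε = 0` the power cancels, and injectivity forces the first component of `v` to be `φ₀
    -- ε`.
    have h2 : J.sumS (v.1 + J.sumS.inverse (b ε)) = J.sumS 0 := by
      rw [_root_.map_zero]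
      exact (smul_eq_zero.1 h1.symm).resolve_left (pow_ne_zero _ hε0)
    show J.coneMap z ψ ε v = J.coneMap z ψ ε (-J.sumS.inverse (b ε), v.2)
    rw [← eq_neg_of_add_eq_zero_left (hS.injective h2)]
  · rintro ⟨ε, hε, hε0, n, hn, rfl⟩
    have hv : ((0 : D.NcProd) + -J.sumS.inverse (b ε), n) ∈ Metric.ball 0 ρ := by
      rw [mem_ball_zero_iff, Prod.norm_mk, zero_add, norm_neg]
      exact max_lt (hU₁ ε hε).1 hn
    have h1 := hG ε hε 0 n hv
    rw [zero_add] at hv h1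
    exact ⟨⟨ε, hε, hε0, _, hv, rfl⟩, by rw [h1, _root_.map_zero, smul_zero]⟩

/-- There are no zeros in the cone when `G(z(ε))` is of order less than `2 * k`. -/
lemma JordanChains.IsLinearizing.exists_no_zeros
    (hψ : J.IsLinearizing G z s U₀ (Metric.ball 0 ρ) ψ)
    (hU₀ : IsOpen U₀) (h0 : (0 : 𝕜) ∈ U₀) {q : ℕ} (hq : q < 2 * k) {b : 𝕜 → F}
    (hb : ContinuousAt b 0) (hGb : ∀ ε ∈ U₀, G (z ε) = ε ^ q • b ε) (hb0 : b 0 ≠ 0) :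
    ∃ U₁ : Set 𝕜, IsOpen U₁ ∧ (0 : 𝕜) ∈ U₁ ∧ U₁ ⊆ U₀ ∧
      ∀ x ∈ J.cone z ψ U₁ (Metric.ball 0 ρ), G x ≠ 0 := by
  -- After division by `ε ^ q` the linear term is at most `‖ε‖ ^ (2 * k - q) * (‖J.sumS‖ * ρ)`,
  -- which tends to `0` while `b ε` does not.
  have hc : ContinuousAt (fun ε : 𝕜 => ‖b ε‖ - ‖ε‖ ^ (2 * k - q) * (‖J.sumS‖ * ρ)) 0 :=
    hb.norm.sub ((by fun_prop : Continuous fun ε : 𝕜 =>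
      ‖ε‖ ^ (2 * k - q) * (‖J.sumS‖ * ρ)).continuousAt)
  have hpos : 0 < ‖b 0‖ - ‖(0 : 𝕜)‖ ^ (2 * k - q) * (‖J.sumS‖ * ρ) := by
    rw [norm_zero, zero_pow (by omega), zero_mul, sub_zero]
    exact norm_pos_iff.2 hb0
  obtain ⟨U₁, hU₁, hU₁o, h0U₁⟩ := eventually_nhds_iff.1
    ((hc.eventually (lt_mem_nhds hpos)).and (hU₀.mem_nhds h0))
  refine ⟨U₁, hU₁o, h0U₁, fun ε hε => (hU₁ ε hε).2, ?_⟩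
  rintro x ⟨ε, hε, hε0, v, hv, rfl⟩ hx
  rw [hψ.linear ε (hU₁ ε hε).2 v hv, hGb ε (hU₁ ε hε).2,
    show 2 * k = q + (2 * k - q) by omega, pow_add, mul_smul, ← smul_add] at hx
  have h1 := (smul_eq_zero.1 hx).resolve_left (pow_ne_zero _ hε0)
  have h2 : ‖b ε‖ = ‖ε‖ ^ (2 * k - q) * ‖J.sumS v.1‖ := by
    rw [eq_neg_of_add_eq_zero_left h1, norm_neg, norm_smul, norm_pow]
  have h3 : ‖J.sumS v.1‖ ≤ ‖J.sumS‖ * ρ := by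
    refine (J.sumS.le_opNorm _).trans (mul_le_mul_of_nonneg_left ?_ (norm_nonneg _))
    exact (norm_fst_le v).trans (mem_ball_zero_iff.1 hv).le
  have h4 := mul_le_mul_of_nonneg_left h3 (pow_nonneg (norm_nonneg ε) (2 * k - q))
  have h5 := (hU₁ ε hε).1
  linarith

end Main

end NewtonLemma

end

theorem corollary1 {𝕜 : Type*} [RCLike 𝕜]
    {B : Type*} [NormedAddCommGroup B] [NormedSpace 𝕜 B] [CompleteSpace B]
    {F : Type*} [NormedAddCommGroup F] [NormedSpace 𝕜 F] [CompleteSpace F]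
    (k : ℕ) (s : ℕ∞) (hs : 1 ≤ s) :
    -- the Jordan chains exist, and `(S 0 ... S k)` is always invertible
    (∀ (U : Set 𝕜) (z : 𝕜 → B) (G : B → F), NewtonLemma.IsSetting (s + k + 1) k U z G →
      ∀ D : NewtonLemma.Decomposition (NewtonLemma.linearization G z) k,
        Nonempty (NewtonLemma.JordanChains D) ∧
        ∀ J : NewtonLemma.JordanChains D, J.sumS.IsInvertible) ∧
    -- the radius `ρ` of `V` and the smallness `δ` depend only on the bound `M`
    ∀ M : ℝ, 0 < M → ∃ ρ : ℝ, 0 < ρ ∧ ∃ δ : ℝ, 0 < δ ∧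
      ∀ (U : Set 𝕜) (z : 𝕜 → B) (G : B → F), NewtonLemma.IsSetting (s + k + 1) k U z G →
      ∀ (D : NewtonLemma.Decomposition (NewtonLemma.linearization G z) k)
        (J : NewtonLemma.JordanChains D),
        ‖J.sumS.inverse‖ ≤ M →
        (∀ x : B, ‖x‖ ≤ 1 / M → ‖fderiv 𝕜 (fderiv 𝕜 G) x‖ ≤ M) →
      ∃ (U₀ : Set 𝕜) (ψ : 𝕜 → D.NcProd × D.N → D.NcProd),
        IsOpen U₀ ∧ (0 : 𝕜) ∈ U₀ ∧ U₀ ⊆ U ∧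
        J.IsLinearizing G z s U₀ (Metric.ball 0 ρ) ψ ∧
        -- (i)
        (∀ b : 𝕜 → F, ContinuousAt b 0 → (∀ ε ∈ U, G (z ε) = ε ^ (2 * k) • b ε) → ‖b 0‖ < δ →
          ∃ U₁ : Set 𝕜, IsOpen U₁ ∧ (0 : 𝕜) ∈ U₁ ∧ U₁ ⊆ U₀ ∧
          ∃ φ₀ : 𝕜 → D.NcProd, (∀ ε, φ₀ ε = -J.sumS.inverse (b ε)) ∧
            (∀ ε ∈ U₁, ‖φ₀ ε‖ < ρ) ∧
            (∀ ε ∈ U₁, ∀ (φ : D.NcProd) (n : D.N), (φ + φ₀ ε, n) ∈ Metric.ball 0 ρ →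
              G (J.coneMap z ψ ε (φ + φ₀ ε, n)) = ε ^ (2 * k) • J.sumS φ) ∧
            {x | x ∈ J.cone z ψ U₁ (Metric.ball 0 ρ) ∧ G x = 0} =
              {x | ∃ ε ∈ U₁, ε ≠ 0 ∧ ∃ n : D.N, ‖n‖ < ρ ∧ x = J.coneMap z ψ ε (φ₀ ε, n)}) ∧
        -- (ii)
        (1 ≤ k → ∀ (q : ℕ) (b : 𝕜 → F), q ≤ 2 * k - 1 → ContinuousAt b 0 →
          (∀ ε ∈ U, G (z ε) = ε ^ q • b ε) → b 0 ≠ 0 →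
          ∃ U₁ : Set 𝕜, IsOpen U₁ ∧ (0 : 𝕜) ∈ U₁ ∧ U₁ ⊆ U₀ ∧
            ∀ x ∈ J.cone z ψ U₁ (Metric.ball 0 ρ), G x ≠ 0) := by
  refine ⟨fun U z G h D => ⟨NewtonLemma.exists_jordanChains (h.contDiffAt_linearization hs)
    h.kSurjective D, fun J => J.sumS_isInvertible h.kSurjective⟩, fun M hM => ?_⟩
  obtain ⟨R, hR, hR1, hR2⟩ : ∃ R : ℝ, 0 < R ∧ 4 * (k + 2) * R ≤ 1 / M ∧
      32 * (k + 2) ^ 2 * M ^ 2 * R ≤ 1 := by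
    refine ⟨min (1 / (4 * (k + 2) * M)) (1 / (32 * (k + 2) ^ 2 * M ^ 2)), by positivity, ?_, ?_⟩
    · calc 4 * (k + 2) * min (1 / (4 * (k + 2) * M)) (1 / (32 * (k + 2) ^ 2 * M ^ 2))
          ≤ 4 * (k + 2) * (1 / (4 * (k + 2) * M)) :=
            mul_le_mul_of_nonneg_left (min_le_left _ _) (by positivity)
        _ = 1 / M := by field_simp
    · calc 32 * (k + 2) ^ 2 * M ^ 2 * min (1 / (4 * (k + 2) * M)) (1 / (32 * (k + 2) ^ 2 * M ^ 2))
          ≤ 32 * (k + 2) ^ 2 * M ^ 2 * (1 / (32 * (k + 2) ^ 2 * M ^ 2)) :=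
            mul_le_mul_of_nonneg_left (min_le_right _ _) (by positivity)
        _ = 1 := by field_simp
  -- Here `ρ = R / 4` and `δ = ρ / M`, so `‖b 0‖ < δ` puts the starting value of `φ₀` inside the
  -- ball of radius `ρ`.
  refine ⟨R / 4, by positivity, R / 4 / M, by positivity, fun U z G h D J hJ hG2 => ?_⟩
  obtain ⟨U₀, ψ, hU₀, h0, hU₀U, hψ⟩ :=
    NewtonLemma.exists_isLinearizing hs h hM hJ hG2 hR hR1 hR2
  refine ⟨U₀, ψ, hU₀, h0, hU₀U, hψ, fun b hb hGb hb0 => ?_, fun hk q b hq hb hGb hb0 => ?_⟩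
  · refine hψ.exists_zeros (J.sumS_isInvertible h.kSurjective) hU₀ h0 hb
      (fun ε hε => hGb ε (hU₀U hε)) ?_
    rw [lt_div_iff₀ hM] at hb0
    calc ‖J.sumS.inverse (b 0)‖ ≤ ‖J.sumS.inverse‖ * ‖b 0‖ := J.sumS.inverse.le_opNorm _
      _ ≤ M * ‖b 0‖ := mul_le_mul_of_nonneg_right hJ (norm_nonneg _)
      _ < R / 4 := by rwa [mul_comm]
  · exact hψ.exists_no_zeros hU₀ h0 (by omega) hb (fun ε hε => hGb ε (hU₀U hε)) hb0
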